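/- Let $X$ be an infinite countable set, $m:X\to(0,\infty)$ and $p\in(1,\infty)$. A connected graph over $(X,m)$ is a symmetric function $b:X\times X\to[0,\infty)$ with zero diagonal, with $\sum_{y}b(x,y)<\infty$ for all $x$, such that any two points are joined by a finite path along pairs with $b>0$. Put $a^{\langle p-1\rangle}=a|a|^{p-2}$ ($=0$ for $a=0$), $\nabla_{xy}f=f(x)-f(y)$, $f_+=\max\{f,0\}$, and call $f$ positive if $f\ge0$ and $f\not\equiv0$. Let $\mathcal F_b(X)$ be the set of $f:X\to\mathbb R$ with $\sum_y b(x,y)|\nabla_{xy}f|^{p-1}<\infty$ for all $x$. For $V:X\to\mathbb R$ the quasilinear Schrödinger operator $\mathcal H=\Delta_p+V$ of $b$ acts on $f\in\mathcal F_b(X)$ by $$\mathcal H[f](x)=\frac1{m(x)}\sum_{y}b(x,y)(\nabla_{xy}f)^{\langle p-1\rangle}+V(x)f(x)^{\langle p-1\rangle}.$$ A function $f\in\mathcal F_b(X)$ is $\mathcal H$-harmonic ($\mathcal H$-superharmonic) if $\mathcal H[f]=0$ ($\ge0$) on $X$, and $\mathcal H$ is called positive if there is a positive $\mathcal H$-superharmonic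 function. Its energy functional on finitely supported $\varphi$ is $$\mathcal Q_{V}(\varphi)=\tfrac12\sum_{x,y}b(x,y)|\nabla_{xy}\varphi|^p+\sum_x m(x)V(x)|\varphi(x)|^p;$$ $\mathcal H$ is critical if $\mathcal Q_V\ge0$ and there is no positive $W:X\to\mathbb R$ with $\mathcal Q_{V-W}\ge0$. An Agmon ground state of a critical operator is a positive superharmonic function of it (it is then strictly positive, harmonic, and unique up to positive multiples). A positive $f\in\mathcal F_b(X)$ is a positive solution of $\mathcal H[f]=0$ of minimal growth at infinity if there is a finite $K_0\subseteq X$ such that $f>0$ and $\mathcal H[f]=0$ on $X\setminus K_0$, and such that for every finite $K\supseteq K_0$ and every $g\in\mathcal F_b(X)$ with $g>0$ and $\mathcal H[g]\ge0$ on $X\setminus K$ and $f\le g$ on $K$ one has $f\le g$ on $X\setminus K$. For $o\in X$, the Green function $G_1$ of $\Delta_p+1$ with pole $o$ is the positive solution of $(\Delta_p+1)G_1=1_{o}$ on $X$ that has minimal growth at infinity for $\Delta_p+1$, where $1_o$ is the characteristic function of $\{o\}$. **Theorem.** Let $\mathcal H=\Delta_p+V$ be a positive quasilinear Schrödinger operator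 associated to a connected graph $b$ over $(X,m)$ with $V\le1$. Let $\tilde{\mathcal H}$ be a critical quasilinear Schrödinger operator (with the same $p$ and an arbitrary real potential $\tilde V$) associated to a connected graph $\tilde b$ over $(X,m)$, with Agmon ground state $v>0$. Let $G_1$ be the Green function of $\Delta_p+1$ for the graph $b$ with some pole $o\in X$. Let $u$ be an $\mathcal H$-harmonic function with $u_+\not\equiv0$ such that for some $C>0$ and all $x,y\in X$ with $u(x)>0$ and $u(y)>0$ $$b(x,y)^{2/p}\,u_+(x)u_+(y)\le C\,\tilde b(x,y)^{2/p}\,v(x)v(y),$$ and, if moreover $b(x,y)>0$, $$b(x,y)^{1-2/p}\,|\nabla_{xy}u_+|^{p-2}\le C\,\tilde b(x,y)^{1-2/p}\,|\nabla_{xy}v|^{p-2}$$ (as an inequality in $[0,\infty]$, where $0^{s}=\infty$ for $s<0$ and $0^0=1$), and such that $$\liminf_{x\to\infty}\frac{u_+(x)}{G_1(x)}=0,$$ where $x\to\infty$ means that $x$ leaves every finite subset of $X$. Then $u\equiv0$. (Equivalently, every $\mathcal H$-harmonic $u$ that satisfies these conditions, except possibly $u_+\not\equiv 0$, has $u_+\equiv0$.)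 -/

import Mathlib

open Filter
open scoped ENNReal

noncomputable section

namespace QuasilinearGraph

/-- A weighted graph over `X`: symmetric nonnegative edge weights with zero diagonal and
summable weights at every vertex (local finiteness is not assumed). -/
structure WeightedGraph (X : Type*) where
  /-- the edge weights -/
  b : X → X → ℝ
  nonneg : ∀ x y, 0 ≤ b x y
  symm : ∀ x y, b x y = b y x
  diag : ∀ x, b x x = 0
  summable : ∀ x, Summable (b x)

variable {X : Type*}

/-- Any two vertices are joined by a finite path of edges of positive weight. -/
def WeightedGraph.Connected (Γ : WeightedGraph X) : Prop :=
  ∀ x y, Relation.ReflTransGen (fun s t => 0 < Γ.b s t) x y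

/-- The signed power `a^⟨r⟩ = a |a|^(r-1)`; its value at `a = 0` is `0`. -/
def spow (a r : ℝ) : ℝ := a * |a| ^ (r - 1)

/-- Positive function: pointwise nonnegative and not identically zero. -/
def Positive (f : X → ℝ) : Prop := 0 ≤ f ∧ f ≠ 0

/-- The domain `F_b(X)` of the `p`-Laplacian. -/
def InDomain (p : ℝ) (Γ : WeightedGraph X) (f : X → ℝ) : Prop :=
  ∀ x, Summable fun y => Γ.b x y * |f x - f y| ^ (p - 1)

/-- The weighted `p`-Laplacian (meaningful on `InDomain p Γ`). -/
def pLaplacian (p : ℝ) (Γ : WeightedGraph X) (m : X → ℝ) (f : X → ℝ) (x : X) : ℝ :=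
  (1 / m x) * ∑' y, Γ.b x y * spow (f x - f y) (p - 1)

/-- The quasilinear Schrödinger operator `H = Δ_p + V`, where `V` acts as
`f ↦ V f^⟨p-1⟩ = V |f|^(p-2) f`. -/
def schrodinger (p : ℝ) (Γ : WeightedGraph X) (m V : X → ℝ) (f : X → ℝ) (x : X) : ℝ :=
  pLaplacian p Γ m f x + V x * spow (f x) (p - 1)

/-- `H`-superharmonic functions. -/
def Superharmonic (p : ℝ) (Γ : WeightedGraph X) (m V : X → ℝ) (f : X → ℝ) : Prop :=
  InDomain p Γ f ∧ ∀ x, 0 ≤ schrodinger p Γ m V f x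

/-- `H`-harmonic functions. -/
def Harmonic (p : ℝ) (Γ : WeightedGraph X) (m V : X → ℝ) (f : X → ℝ) : Prop :=
  InDomain p Γ f ∧ ∀ x, schrodinger p Γ m V f x = 0

/-- `H ≥ 0`: there is a positive `H`-superharmonic function. -/
def PositiveOperator (p : ℝ) (Γ : WeightedGraph X) (m V : X → ℝ) : Prop :=
  ∃ w : X → ℝ, Positive w ∧ Superharmonic p Γ m V w

/-- The energy functional of `H`; it is used for finitely supported `φ` only, for which both
sums converge. -/
def energy (p : ℝ) (Γ : WeightedGraph X) (m V : X → ℝ) (φ : X → ℝ) : ℝ :=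
  (1 / 2) * (∑' z : X × X, Γ.b z.1 z.2 * |φ z.1 - φ z.2| ^ p) + ∑' x, m x * V x * |φ x| ^ p

/-- The energy functional is nonnegative on finitely supported functions. -/
def EnergyNonneg (p : ℝ) (Γ : WeightedGraph X) (m V : X → ℝ) : Prop :=
  ∀ φ : X → ℝ, φ.support.Finite → 0 ≤ energy p Γ m V φ

/-- Criticality: the energy functional is nonnegative, and it does not stay nonnegative when any
positive function `W` is subtracted from the potential. -/
def Critical (p : ℝ) (Γ : WeightedGraph X) (m V : X → ℝ) : Prop :=
  EnergyNonneg p Γ m V ∧ ∀ W : X → ℝ, Positive W → ¬ EnergyNonneg p Γ m (V - W)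

/-- Agmon ground state of a critical operator: its positive superharmonic function. That it is
strictly positive, harmonic, and unique up to positive multiples are theorems about critical
operators and not part of the definition. -/
def AgmonGroundState (p : ℝ) (Γ : WeightedGraph X) (m V : X → ℝ) (v : X → ℝ) : Prop :=
  Critical p Γ m V ∧ Positive v ∧ Superharmonic p Γ m V v

/-- `f` is a positive solution of `H f = 0` of minimal growth at infinity. -/
def MinimalGrowth (p : ℝ) (Γ : WeightedGraph X) (m V : X → ℝ) (f : X → ℝ) : Prop :=
  Positive f ∧ InDomain p Γ f ∧
    ∃ K₀ : Finset X, (∀ x ∉ K₀, 0 < f x ∧ schrodinger p Γ m V f x = 0) ∧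
      ∀ K : Finset X, K₀ ⊆ K → ∀ g : X → ℝ, InDomain p Γ g →
        (∀ x ∉ K, 0 < g x ∧ 0 ≤ schrodinger p Γ m V g x) →
        (∀ x ∈ K, f x ≤ g x) → ∀ x ∉ K, f x ≤ g x

/-- `G` is the minimal positive Green function `G_α` with pole `o`: `(Δ_p + α) G = 1_o`, and `G`
has minimal growth at infinity for `Δ_p + α`. -/
def GreenFunction (p : ℝ) (Γ : WeightedGraph X) (m : X → ℝ) (α : ℝ) (o : X) (G : X → ℝ) : Prop :=
  (∀ x, schrodinger p Γ m (fun _ => α) G x = Set.indicator {o} 1 x) ∧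
    MinimalGrowth p Γ m (fun _ => α) G

/-- The extended nonnegative number `β^(1-2/p) |t|^(p-2)`, where `0` to a negative power is `∞`
and `0^0 = 1`. -/
def gradWeight (p β t : ℝ) : ℝ≥0∞ :=
  ENNReal.ofReal β ^ (1 - 2 / p) * ENNReal.ofReal |t| ^ (p - 2)

end QuasilinearGraph

end

noncomputable section

open scoped Topology

namespace QuasilinearGraph

/-! The hypotheses are contradictory: they force `u > 0` everywhere, and then `u` cannot be small
against the Green function.

The tool is a ground state representation. If `w > 0` is superharmonic, the energy of `w ψ` is half
the sum over edges of a nonnegative Picone remainder plus a nonnegative potential term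
(`energy_mul_eq`). The remainder is comparable, with constants depending only on `p`, to a
simplified energy whose dependence on `w` is through products and differences at the endpoints
(`picone_bounds`). These are the quantities that the two hypotheses on `u⁺` and `v` compare, so
remainders pass from `v` to `u⁺` (`simplified_comparison`).

Criticality gives finitely supported `φ n ≥ 0`, equal to `1` at a point `q` with `u⁺ q > 0`, whose
energies tend to zero. Their remainders with respect to `v` tend to zero, so by connectedness `φ n /
v` converges pointwise to a positive constant. By the comparison, and since `u⁺` is subharmonic
where it is positive, the energies of `u⁺ φ n / v` for the first operator are bounded above by a
null sequence. Represented through a positive superharmonic `w` of that operator, they force `u⁺ φ n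
/ (v w)` to have a constant limit too. Hence `u⁺ / w` is constant; it is positive at `q`, so `u > 0`
(`Harmonic.pos_of_comparison`).

As `V ≤ 1`, such a `u` is superharmonic for `Δ_p + 1`, and minimal growth yields `G ≤ l u` off a
finite set. This contradicts the vanishing lower limit of `u⁺ / G`. -/

/-! ### Two-sided bounds for the Bregman divergence of `|·|^p`. -/

theorem rpow_le_of_comparable {x y : ℝ} (q : ℝ) (hx : 0 < x) (hy : 0 < y) (hxy : x ≤ 2 * y)
    (hyx : y ≤ 2 * x) : x ^ q ≤ 2 ^ |q| * y ^ q := by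
  rcases le_total 0 q with hq | hq
  · rw [abs_of_nonneg hq, ← Real.mul_rpow (by norm_num) hy.le]
    exact Real.rpow_le_rpow hx.le hxy hq
  · have h : x ^ q ≤ (y / 2) ^ q := Real.rpow_le_rpow_of_nonpos (by positivity) (by linarith) hq
    rw [Real.div_rpow hy.le (by norm_num)] at h
    rw [abs_of_nonpos hq, Real.rpow_neg (by norm_num)]
    calc x ^ q ≤ y ^ q / 2 ^ q := h
      _ = _ := by rw [div_eq_mul_inv, mul_comm]

/-- The Bregman divergence of `|·|^p` between `s + h` and `s ≥ 0`. -/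
def bregman (p s h : ℝ) : ℝ := |s + h| ^ p - s ^ p - p * s ^ (p - 1) * h

theorem bregman_smul (p : ℝ) {r s : ℝ} (h : ℝ) (hr : 0 < r) (hs : 0 ≤ s) :
    bregman p (r * s) (r * h) = r ^ p * bregman p s h := by
  unfold bregman
  have h1 : r ^ p = r ^ (p - 1) * r := by
    rw [← Real.rpow_add_one hr.ne']; congr 1; ring
  rw [← mul_add, abs_mul, abs_of_pos hr, Real.mul_rpow hr.le (abs_nonneg _),
    Real.mul_rpow hr.le hs, Real.mul_rpow hr.le hs, h1]
  ring

/-- Strict convexity of `|·|^p`: scaling reduces to `s = 1`, where it is Bernoulli's inequality. -/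
theorem bregman_pos {p s h : ℝ} (hp : 1 < p) (hs : 0 ≤ s) (hh : h ≠ 0) : 0 < bregman p s h := by
  have key : ∀ k : ℝ, k ≠ 0 → 0 < bregman p 1 k := by
    intro k hk
    unfold bregman
    simp only [Real.one_rpow, mul_one]
    rcases le_total (-1) k with h1 | h1
    · have := one_add_mul_self_lt_rpow_one_add h1 hk hp
      rw [abs_of_nonneg (by linarith)]
      linarith
    · have : 0 ≤ |1 + k| ^ p := by positivity
      nlinarith
  rcases hs.eq_or_lt with rfl | hs
  · unfold bregman
    rw [Real.zero_rpow (by linarith), Real.zero_rpow (by linarith)]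
    simp only [zero_add, sub_zero, mul_zero, zero_mul]
    have := abs_pos.2 hh
    positivity
  · have := bregman_smul p (h / s) hs (zero_le_one)
    rw [mul_one, mul_div_cancel₀ _ hs.ne'] at this
    rw [this]
    have := key (h / s) (div_ne_zero hh hs.ne')
    positivity

/-- The limit is the second Taylor coefficient of `(1 + k)^p`, found by one use of l'Hôpital and the
derivative of `(1 + k)^(p-1)` at zero. -/
theorem tendsto_bregman_div_sq {p : ℝ} :
    Tendsto (fun k => bregman p 1 k / k ^ 2) (𝓝[≠] 0) (𝓝 (p * (p - 1) / 2)) := by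
  have hpos : ∀ᶠ k : ℝ in 𝓝 0, 0 < 1 + k :=
    (continuous_const.add continuous_id).tendsto (0 : ℝ) |>.eventually (lt_mem_nhds (by norm_num))
  have hd : ∀ (q k : ℝ), 0 < 1 + k → HasDerivAt (fun k : ℝ => (1 + k) ^ q)
      (q * (1 + k) ^ (q - 1)) k := by
    intro q k hk
    have := ((hasDerivAt_id k).const_add 1).rpow_const (p := q) (Or.inl hk.ne')
    simpa using this
  have hlim : Tendsto (fun k : ℝ => (p * (1 + k) ^ (p - 1) - p) / (2 * k)) (𝓝[≠] 0)
      (𝓝 (p * (p - 1) / 2)) := by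
    have h1 := (hasDerivAt_iff_tendsto_slope_zero.1 (hd (p - 1) 0 (by norm_num)))
    simp only [zero_add, add_zero, Real.one_rpow, mul_one, smul_eq_mul] at h1
    have h2 := h1.const_mul (p / 2)
    convert h2 using 1
    · ext k
      by_cases hk : k = 0
      · simp [hk]
      · field_simp
    · congr 1; ring
  have := HasDerivAt.lhopital_zero_nhdsNE (a := (0 : ℝ))
    (f := fun k => (1 + k) ^ p - 1 - p * k) (g := fun k => k ^ 2)
    (f' := fun k => p * (1 + k) ^ (p - 1) - p) (g' := fun k => 2 * k) ?_ ?_ ?_ ?_ ?_ hlim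
  · refine this.congr' ?_
    filter_upwards [nhdsWithin_le_nhds hpos] with k hk
    simp [bregman, abs_of_pos hk]
  · filter_upwards [nhdsWithin_le_nhds hpos] with k hk
    have := ((hd p k hk).sub_const 1).fun_sub ((hasDerivAt_id k).const_mul p)
    simpa using this
  · filter_upwards with k
    simpa using hasDerivAt_pow 2 k
  · filter_upwards [self_mem_nhdsWithin] with k hk
    exact mul_ne_zero two_ne_zero hk
  · have : ContinuousAt (fun k : ℝ => (1 + k) ^ p - 1 - p * k) 0 :=
      (((hd p 0 (by norm_num)).continuousAt.sub continuousAt_const).sub (by fun_prop))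
    have h := this.tendsto
    simp only [add_zero, Real.one_rpow, sub_self, mul_zero] at h
    exact h.mono_left nhdsWithin_le_nhds
  · have : Continuous (fun k : ℝ => k ^ 2) := by fun_prop
    have h := this.tendsto 0
    simp only [ne_eq, OfNat.ofNat_ne_zero, not_false_eq_true, zero_pow] at h
    exact h.mono_left nhdsWithin_le_nhds

theorem bregman_local {p : ℝ} (hp : 1 < p) : ∃ η > 0, η ≤ 1 ∧ ∀ k : ℝ, |k| ≤ η →
    p * (p - 1) / 4 * k ^ 2 ≤ bregman p 1 k ∧ bregman p 1 k ≤ p * (p - 1) * k ^ 2 := by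
  have hpp : 0 < p * (p - 1) := mul_pos (by linarith) (by linarith)
  have h := (tendsto_bregman_div_sq (p := p)).eventually
    (Ioo_mem_nhds (a := p * (p - 1) / 4) (b := p * (p - 1)) (by linarith) (by linarith))
  rw [eventually_nhdsWithin_iff, Metric.eventually_nhds_iff] at h
  obtain ⟨ε, hε, h⟩ := h
  refine ⟨min (ε / 2) 1, by positivity, min_le_right _ _, fun k hk => ?_⟩
  by_cases hk0 : k = 0
  · simp [hk0, bregman]
  have h1 := h (y := k) (by
    rw [Real.dist_eq, sub_zero]; have := hk.trans (min_le_left _ _); linarith) hk0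
  have hk2 : 0 < k ^ 2 := by positivity
  rw [lt_div_iff₀ hk2, div_lt_iff₀ hk2] at h1
  exact ⟨h1.1.le, h1.2.le⟩

/-- Under the normalization `s + |h| = 1`, increments away from zero form a compact set on which the
divergence is continuous and positive. -/
theorem bregman_far {p η : ℝ} (hp : 1 < p) (hη : 0 < η) (hη1 : η ≤ 1) :
    ∃ c > 0, ∃ C > 0, ∀ h : ℝ, η ≤ |h| → |h| ≤ 1 →
      c ≤ bregman p (1 - |h|) h ∧ bregman p (1 - |h|) h ≤ C := by
  have hcpt : IsCompact (Set.Icc (-1 : ℝ) 1 ∩ {h | η ≤ |h|}) :=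
    isCompact_Icc.inter_right (isClosed_le continuous_const continuous_abs)
  have hne : (Set.Icc (-1 : ℝ) 1 ∩ {h | η ≤ |h|}).Nonempty := ⟨1, by simp [hη1]⟩
  have hcont : Continuous fun h : ℝ => bregman p (1 - |h|) h := by
    unfold bregman
    refine ((Continuous.rpow_const (by fun_prop) fun _ => Or.inr (by linarith)).sub
      (Continuous.rpow_const (by fun_prop) fun _ => Or.inr (by linarith))).sub
      ((continuous_const.mul (Continuous.rpow_const (by fun_prop)
        fun _ => Or.inr (by linarith))).mul continuous_id)
  obtain ⟨x, hx, hmin⟩ := hcpt.exists_isMinOn hne hcont.continuousOn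
  obtain ⟨y, hy, hmax⟩ := hcpt.exists_isMaxOn hne hcont.continuousOn
  have hpos : ∀ z ∈ Set.Icc (-1 : ℝ) 1 ∩ {h | η ≤ |h|}, 0 < bregman p (1 - |z|) z := by
    rintro z ⟨hz1, hz2⟩
    exact bregman_pos hp (by linarith [abs_le.2 hz1]) (abs_pos.1 (hη.trans_le hz2))
  refine ⟨_, hpos x hx, _, hpos y hy, fun h h1 h2 => ?_⟩
  have hm : h ∈ Set.Icc (-1 : ℝ) 1 ∩ {h | η ≤ |h|} := ⟨abs_le.1 h2, h1⟩
  exact ⟨hmin hm, hmax hm⟩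

/-- Both sides are homogeneous of degree `p` in `(s, h)`, so only the ratio of `h` to `s` matters:
Taylor expansion covers small ratios, compactness the others. -/
theorem bregman_bounds {p : ℝ} (hp : 1 < p) : ∃ c > 0, ∃ C > 0, ∀ s h : ℝ, 0 ≤ s →
    c * (h ^ 2 * (s + |h|) ^ (p - 2)) ≤ bregman p s h ∧
      bregman p s h ≤ C * (h ^ 2 * (s + |h|) ^ (p - 2)) := by
  obtain ⟨η, hη, hη1, hloc⟩ := bregman_local hp
  obtain ⟨c, hc, C, hC, hfar⟩ := bregman_far hp (η := η / 2) (by positivity) (by linarith)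
  have hpp : 0 < p * (p - 1) := mul_pos (by linarith) (by linarith)
  set D : ℝ := 2 ^ |p - 2| with hD
  have hDpos : 0 < D := by positivity
  refine ⟨min (p * (p - 1) / 4 / D) c, by positivity,
    max (p * (p - 1) * D) (C * (4 / η ^ 2)), by positivity, fun s h hs => ?_⟩
  by_cases hh : h = 0
  · simp [hh, bregman, abs_of_nonneg hs]
  have hh' : 0 < |h| := abs_pos.2 hh
  have hr : 0 < s + |h| := by linarith
  have hE : 0 ≤ h ^ 2 * (s + |h|) ^ (p - 2) := by positivity
  suffices H : (p * (p - 1) / 4 / D * (h ^ 2 * (s + |h|) ^ (p - 2)) ≤ bregman p s h ∨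
      c * (h ^ 2 * (s + |h|) ^ (p - 2)) ≤ bregman p s h) ∧
      (bregman p s h ≤ p * (p - 1) * D * (h ^ 2 * (s + |h|) ^ (p - 2)) ∨
      bregman p s h ≤ C * (4 / η ^ 2) * (h ^ 2 * (s + |h|) ^ (p - 2))) by
    constructor
    · rcases H.1 with H | H
      · exact (mul_le_mul_of_nonneg_right (min_le_left _ _) hE).trans H
      · exact (mul_le_mul_of_nonneg_right (min_le_right _ _) hE).trans H
    · rcases H.2 with H | H
      · exact H.trans (mul_le_mul_of_nonneg_right (le_max_left _ _) hE)
      · exact H.trans (mul_le_mul_of_nonneg_right (le_max_right _ _) hE)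
  have hpow : ∀ r : ℝ, 0 < r → r ^ p = r ^ (p - 2) * r ^ 2 := by
    intro r hr
    rw [← Real.rpow_natCast r 2, ← Real.rpow_add hr]; congr 1; norm_num
  rcases le_or_gt |h| (η * s) with hcase | hcase
  · have hs0 : 0 < s := by
      by_contra hcon
      have : s = 0 := le_antisymm (not_lt.1 hcon) hs
      subst this
      simp at hcase
      exact hh hcase
    have hhs : |h| ≤ s := hcase.trans (by nlinarith)
    have e := bregman_smul p (h / s) hs0 zero_le_one
    rw [mul_one, mul_div_cancel₀ _ hs0.ne', hpow s hs0] at e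
    have hk : |h / s| ≤ η := by
      rw [abs_div, abs_of_pos hs0, div_le_iff₀ hs0]; exact hcase
    obtain ⟨l1, l2⟩ := hloc _ hk
    have e2 : s ^ (p - 2) * s ^ 2 * (h / s) ^ 2 = s ^ (p - 2) * h ^ 2 := by
      field_simp
    have hsp : 0 < s ^ (p - 2) * s ^ 2 := by positivity
    have l1' := mul_le_mul_of_nonneg_left l1 hsp.le
    have l2' := mul_le_mul_of_nonneg_left l2 hsp.le
    rw [← e] at l1' l2'
    have q1 : (s + |h|) ^ (p - 2) ≤ D * s ^ (p - 2) :=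
      rpow_le_of_comparable _ hr hs0 (by linarith) (by linarith)
    have q2 : s ^ (p - 2) ≤ D * (s + |h|) ^ (p - 2) :=
      rpow_le_of_comparable _ hs0 hr (by linarith) (by linarith)
    refine ⟨Or.inl ?_, Or.inl ?_⟩
    · refine le_trans ?_ l1'
      calc p * (p - 1) / 4 / D * (h ^ 2 * (s + |h|) ^ (p - 2))
          ≤ p * (p - 1) / 4 / D * (h ^ 2 * (D * s ^ (p - 2))) := by gcongr
        _ = p * (p - 1) / 4 * (s ^ (p - 2) * h ^ 2) := by field_simp
        _ = _ := by rw [← e2]; ring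
    · refine l2'.trans ?_
      calc s ^ (p - 2) * s ^ 2 * (p * (p - 1) * (h / s) ^ 2)
          = p * (p - 1) * (s ^ (p - 2) * h ^ 2) := by rw [← e2]; ring
        _ ≤ p * (p - 1) * (D * (s + |h|) ^ (p - 2) * h ^ 2) := by gcongr
        _ = _ := by ring
  · set r := s + |h| with hrdef
    have hk1 : |h / r| ≤ 1 := by
      rw [abs_div, abs_of_pos hr, div_le_iff₀ hr]; linarith
    -- Since `|h| > η s` and `η ≤ 1`, the ratio is at least `η / (1 + η)`, which explains `η / 2` in
    -- the compactness bound.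
    have hk2 : η / 2 ≤ |h / r| := by
      rw [abs_div, abs_of_pos hr, le_div_iff₀ hr]; nlinarith
    have e := bregman_smul p (s := 1 - |h / r|) (h / r) hr (by linarith)
    have e1 : r * (1 - |h / r|) = s := by
      rw [abs_div, abs_of_pos hr]; field_simp; linarith
    rw [e1, mul_div_cancel₀ _ hr.ne', hpow r hr] at e
    obtain ⟨l1, l2⟩ := hfar _ hk2 hk1
    have hrp : 0 < r ^ (p - 2) := by positivity
    have hsq1 : h ^ 2 ≤ r ^ 2 := by
      rw [← sq_abs]; gcongr; linarith
    have hsq2 : r ^ 2 ≤ 4 / η ^ 2 * h ^ 2 := by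
      have : η * r ≤ 2 * |h| := by nlinarith
      have : (η * r) ^ 2 ≤ (2 * |h|) ^ 2 := by gcongr
      rw [div_mul_eq_mul_div, le_div_iff₀ (by positivity)]
      rw [mul_pow, mul_pow, sq_abs] at this
      linarith
    rw [e]
    have hb : 0 ≤ bregman p (1 - |h / r|) (h / r) := hc.le.trans l1
    refine ⟨Or.inr ?_, Or.inr ?_⟩
    · calc c * (h ^ 2 * r ^ (p - 2)) ≤ bregman p (1 - |h / r|) (h / r) * (r ^ 2 * r ^ (p - 2)) := by
            gcongr
        _ = _ := by ring
    · calc r ^ (p - 2) * r ^ 2 * bregman p (1 - |h / r|) (h / r)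
          ≤ r ^ (p - 2) * (4 / η ^ 2 * h ^ 2) * C := by gcongr
        _ = _ := by ring

/-! ### The Picone remainder and the simplified energy. -/

/-- The Picone remainder of an edge: `w` takes the values `a, a'` and `φ = w ψ`, where `ψ` takes
the values `s, s'`. -/
def picone (p a a' s s' : ℝ) : ℝ :=
  |a * s - a' * s'| ^ p - spow (a - a') (p - 1) * (a * s ^ p - a' * s' ^ p)

/-- The simplified energy of an edge. -/
def simplified (p a a' s s' : ℝ) : ℝ :=
  a * a' * (s - s') ^ 2 * (√(a * a') * |s - s'| + |a - a'| * (s + s')) ^ (p - 2)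

theorem picone_comm (p a a' s s' : ℝ) : picone p a a' s s' = picone p a' a s' s := by
  unfold picone spow
  rw [abs_sub_comm (a * s), abs_sub_comm a]
  ring

theorem simplified_comm (p a a' s s' : ℝ) : simplified p a a' s s' = simplified p a' a s' s := by
  unfold simplified
  rw [abs_sub_comm s, abs_sub_comm a, mul_comm a a', add_comm s s']
  ring

/-- Edges on which `u⁺` vanishes at an endpoint cost nothing, so the comparison hypotheses are
needed only where `u` is positive at both ends. -/
theorem picone_zero_right {p a s s' : ℝ} (hp : 1 < p) (ha : 0 ≤ a) (hs : 0 ≤ s) :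
    picone p a 0 s s' = 0 := by
  unfold picone spow
  rcases ha.eq_or_lt with rfl | ha
  · simp [Real.zero_rpow (show p ≠ 0 by linarith)]
  · simp only [zero_mul, sub_zero]
    rw [abs_of_nonneg (by positivity), abs_of_pos ha, Real.mul_rpow ha.le hs]
    have : a ^ p = a ^ (p - 1 - 1) * a * a := by
      rw [← Real.rpow_add_one ha.ne', ← Real.rpow_add_one ha.ne']; congr 1; ring
    rw [this]; ring

/-- The Picone remainder is a sum of two Bregman divergences. -/
theorem picone_eq_bregman {p a a' s s' : ℝ} (haa : a' < a) (hs' : 0 ≤ s') :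
    picone p a a' s s' = (a - a') ^ (p - 1) *
      ((a - a') * bregman p s (a' * (s - s') / (a - a')) + a' * bregman p s (s' - s)) := by
  have hd : 0 < a - a' := by linarith
  unfold picone spow bregman
  have e1 : s + a' * (s - s') / (a - a') = (a * s - a' * s') / (a - a') := by
    field_simp; ring
  have e2 : (a - a') ^ p = (a - a') ^ (p - 1) * (a - a') := by
    rw [← Real.rpow_add_one hd.ne']; congr 1; ring
  have e3 : (a - a') * (a - a') ^ (p - 1 - 1) = (a - a') ^ (p - 1) := by
    rw [mul_comm, ← Real.rpow_add_one hd.ne']; congr 1; ring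
  have e5 : |a * s - a' * s'| ^ p =
      (a - a') ^ (p - 1) * (a - a') * |(a * s - a' * s') / (a - a')| ^ p := by
    rw [← e2, abs_div, abs_of_pos hd, Real.div_rpow (abs_nonneg _) hd.le]
    field_simp
  have e6 : (a - a') * (a' * (s - s') / (a - a')) = a' * (s - s') := by field_simp
  rw [e1, abs_of_pos hd, e3, add_sub_cancel, abs_of_nonneg hs', e5]
  -- The linear terms of the two divergences cancel: both have slope `p s^(p-1)`, and their weighted
  -- increments are opposite.
  linear_combination (a - a') ^ (p - 1) * p * s ^ (p - 1) * e6

/-- The base `x + a' δ` lies between `a' / a` times `x + a δ` and `x + a δ` itself; the sign of `q`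
decides which end bounds the power from above. -/
theorem scaled_term_bounds {a' a x δ : ℝ} (q : ℝ) (ha' : 0 < a') (haa : a' ≤ a) (hx : 0 ≤ x)
    (hδ : 0 < δ) :
    (0 ≤ q → (a' / a) ^ (q + 1) * (a * (x + a * δ) ^ q) ≤ a' * (x + a' * δ) ^ q ∧
      a' * (x + a' * δ) ^ q ≤ a' * (x + a * δ) ^ q) ∧
    (q ≤ 0 → a' * (x + a * δ) ^ q ≤ a' * (x + a' * δ) ^ q ∧
      a' * (x + a' * δ) ^ q ≤ (a' / a) ^ (q + 1) * (a * (x + a * δ) ^ q)) := by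
  have ha : 0 < a := ha'.trans_le haa
  have h1 : x + a' * δ ≤ x + a * δ := by gcongr
  have h0 : 0 < x + a' * δ := by positivity
  have h2 : a' / a * (x + a * δ) ≤ x + a' * δ := by
    have : a' / a * x ≤ x := mul_le_of_le_one_left hx ((div_le_one ha).2 haa)
    have : a' / a * (a * δ) = a' * δ := by field_simp
    linarith
  have h3 : (a' / a) ^ (q + 1) * (a * (x + a * δ) ^ q) = a' * (a' / a * (x + a * δ)) ^ q := by
    rw [Real.mul_rpow (by positivity) (by positivity), Real.rpow_add_one (by positivity)]
    field_simp
  rw [h3]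
  refine ⟨fun hq => ⟨?_, ?_⟩, fun hq => ⟨?_, ?_⟩⟩
  · gcongr
  · gcongr
  · exact mul_le_mul_of_nonneg_left (Real.rpow_le_rpow_of_nonpos h0 h1 hq) ha'.le
  · exact mul_le_mul_of_nonneg_left
      (Real.rpow_le_rpow_of_nonpos (by positivity) h2 hq) ha'.le

/-- It merges the two divergences in the Picone remainder into one term. The larger of `a'`, `d` is
at least half the sum, whence the power of `1 / 2`; `q > -1` keeps the exponent `q + 1` positive. -/
theorem split_term_bounds {q : ℝ} (hq : -1 < q) : ∃ c > 0, ∃ C > 0, ∀ a' d x δ : ℝ,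
    0 < a' → 0 < d → 0 ≤ x → 0 < δ →
    c * ((a' + d) * (x + (a' + d) * δ) ^ q) ≤ a' * (x + a' * δ) ^ q + d * (x + d * δ) ^ q ∧
    a' * (x + a' * δ) ^ q + d * (x + d * δ) ^ q ≤ C * ((a' + d) * (x + (a' + d) * δ) ^ q) := by
  refine ⟨min 1 ((1 / 2) ^ (q + 1)), by positivity, 2, by norm_num,
    fun a' d x δ ha' hd hx hδ => ?_⟩
  obtain ⟨A1, A2⟩ := scaled_term_bounds q ha' (by linarith : a' ≤ a' + d) hx hδ
  obtain ⟨B1, B2⟩ := scaled_term_bounds q hd (by linarith : d ≤ a' + d) hx hδ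
  have hM : 0 ≤ (a' + d) * (x + (a' + d) * δ) ^ q := by positivity
  rcases le_total 0 q with h | h
  · obtain ⟨a1, a2⟩ := A1 h
    obtain ⟨b1, b2⟩ := B1 h
    constructor
    · refine (mul_le_mul_of_nonneg_right (min_le_right _ _) hM).trans ?_
      rcases le_total d a' with h' | h'
      · have : (1 / 2 : ℝ) ^ (q + 1) ≤ (a' / (a' + d)) ^ (q + 1) := by
          apply Real.rpow_le_rpow (by norm_num) _ (by linarith)
          rw [div_le_div_iff₀ (by norm_num) (by linarith)]; linarith
        have h3 := (mul_le_mul_of_nonneg_right this hM).trans a1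
        have : 0 ≤ d * (x + d * δ) ^ q := by positivity
        linarith
      · have : (1 / 2 : ℝ) ^ (q + 1) ≤ (d / (a' + d)) ^ (q + 1) := by
          apply Real.rpow_le_rpow (by norm_num) _ (by linarith)
          rw [div_le_div_iff₀ (by norm_num) (by linarith)]; linarith
        have h3 := (mul_le_mul_of_nonneg_right this hM).trans b1
        have : 0 ≤ a' * (x + a' * δ) ^ q := by positivity
        linarith
    · linarith [add_mul a' d ((x + (a' + d) * δ) ^ q)]
  · obtain ⟨a1, a2⟩ := A2 h
    obtain ⟨b1, b2⟩ := B2 h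
    constructor
    · refine (mul_le_mul_of_nonneg_right (min_le_left _ _) hM).trans ?_
      linarith [add_mul a' d ((x + (a' + d) * δ) ^ q)]
    · have h1 : (a' / (a' + d)) ^ (q + 1) ≤ 1 := Real.rpow_le_one (by positivity)
        ((div_le_one (by linarith)).2 (by linarith)) (by linarith)
      have h2 : (d / (a' + d)) ^ (q + 1) ≤ 1 := Real.rpow_le_one (by positivity)
        ((div_le_one (by linarith)).2 (by linarith)) (by linarith)
      linarith [mul_le_mul_of_nonneg_right h1 hM, mul_le_mul_of_nonneg_right h2 hM]

set_option maxHeartbeats 400000 in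
/-- The Picone remainder is comparable to the simplified energy. -/
theorem picone_bounds {p : ℝ} (hp : 1 < p) : ∃ c > 0, ∃ C > 0, ∀ a a' s s' : ℝ,
    0 < a → 0 < a' → 0 ≤ s → 0 ≤ s' →
    c * simplified p a a' s s' ≤ picone p a a' s s' ∧
      picone p a a' s s' ≤ C * simplified p a a' s s' := by
  obtain ⟨c₁, hc₁, C₁, hC₁, hb⟩ := bregman_bounds hp
  obtain ⟨c₂, hc₂, C₂, hC₂, ht⟩ := split_term_bounds (q := p - 2) (by linarith)
  set D : ℝ := 2 ^ |p - 2| with hD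
  have hDpos : 0 < D := by positivity
  -- Symmetry in the endpoints reduces to `a' < a`. For `a = a'` the two expressions coincide, which
  -- accounts for the constants `1` below.
  suffices H : ∀ a a' s s' : ℝ, 0 < a' → a' < a → 0 ≤ s → 0 ≤ s' →
      c₁ * c₂ / D * simplified p a a' s s' ≤ picone p a a' s s' ∧
      picone p a a' s s' ≤ C₁ * C₂ * D * simplified p a a' s s' by
    have hnn : ∀ a a' s s' : ℝ, 0 < a → 0 < a' → 0 ≤ s → 0 ≤ s' →
        0 ≤ simplified p a a' s s' := by
      intro a a' s s' ha ha' hs hs'; unfold simplified; positivity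
    refine ⟨min (c₁ * c₂ / D) 1, by positivity, max (C₁ * C₂ * D) 1, by positivity,
      fun a a' s s' ha ha' hs hs' => ?_⟩
    have h0 := hnn a a' s s' ha ha' hs hs'
    have hl := mul_le_mul_of_nonneg_right (min_le_left (c₁ * c₂ / D) 1) h0
    have hl' := mul_le_mul_of_nonneg_right (min_le_right (c₁ * c₂ / D) 1) h0
    have hr := mul_le_mul_of_nonneg_right (le_max_left (C₁ * C₂ * D) 1) h0
    have hr' := mul_le_mul_of_nonneg_right (le_max_right (C₁ * C₂ * D) 1) h0
    rcases lt_trichotomy a a' with h | h | h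
    · obtain ⟨l, r⟩ := H a' a s' s ha h hs' hs
      rw [picone_comm, simplified_comm] at l r
      exact ⟨hl.trans l, r.trans hr⟩
    · subst h
      have e : picone p a a s s' = simplified p a a s s' := by
        unfold picone simplified spow
        rw [Real.sqrt_mul_self ha.le]
        simp only [sub_self, abs_zero, zero_mul, add_zero, sub_zero]
        rw [← mul_sub, abs_mul, abs_of_pos ha]
        rcases (abs_nonneg (s - s')).eq_or_lt with h | h
        · have : s - s' = 0 := abs_eq_zero.1 h.symm
          simp [this, Real.zero_rpow (show p ≠ 0 by linarith)]
        · have : 0 < a * |s - s'| := by positivity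
          rw [← sq_abs (s - s'), show a * a * |s - s'| ^ 2 = (a * |s - s'|) ^ (2 : ℝ) by
            rw [Real.rpow_two]; ring, ← Real.rpow_add this]
          congr 1; ring
      rw [e] at *
      exact ⟨by linarith, by linarith⟩
    · obtain ⟨l, r⟩ := H a a' s s' ha' h hs hs'
      exact ⟨hl.trans l, r.trans hr⟩
  intro a a' s s' ha' haa hs hs'
  rw [picone_eq_bregman haa hs']
  by_cases hss : s = s'
  · subst hss
    simp [bregman, simplified, abs_of_nonneg hs]
  obtain ⟨d, rfl⟩ : ∃ d, a = a' + d := ⟨a - a', by ring⟩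
  have hd : 0 < d := by linarith
  rw [add_sub_cancel_left]
  have hδ : 0 < |s - s'| := abs_pos.2 (sub_ne_zero.2 hss)
  obtain ⟨x1, x2⟩ := hb s (a' * (s - s') / d) hs
  obtain ⟨y1, y2⟩ := hb s (s' - s) hs
  obtain ⟨z1, z2⟩ := ht a' d (d * s) |s - s'| ha' hd (by positivity) hδ
  have hdp : d ^ (p - 1) = d ^ (p - 2) * d := by
    rw [← Real.rpow_add_one hd.ne']; congr 1; ring
  have ex : d ^ (p - 1) * (d * ((a' * (s - s') / d) ^ 2 * (s + |a' * (s - s') / d|) ^ (p - 2))) =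
      a' * |s - s'| ^ 2 * (a' * (d * s + a' * |s - s'|) ^ (p - 2)) := by
    have : d * s + a' * |s - s'| = d * (s + |a' * (s - s') / d|) := by
      rw [abs_div, abs_mul, abs_of_pos hd, abs_of_pos ha']; field_simp
    rw [this, Real.mul_rpow hd.le (by positivity), hdp, sq_abs]
    field_simp
  have ey : d ^ (p - 1) * (a' * ((s' - s) ^ 2 * (s + |s' - s|) ^ (p - 2))) =
      a' * |s - s'| ^ 2 * (d * (d * s + d * |s - s'|) ^ (p - 2)) := by
    rw [abs_sub_comm s' s, ← mul_add, Real.mul_rpow hd.le (by positivity), hdp, sq_abs]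
    ring
  set X := (a' * (s - s') / d) ^ 2 * (s + |a' * (s - s') / d|) ^ (p - 2)
  set Y := (s' - s) ^ 2 * (s + |s' - s|) ^ (p - 2)
  set S := a' * (d * s + a' * |s - s'|) ^ (p - 2) + d * (d * s + d * |s - s'|) ^ (p - 2)
  have hS : d ^ (p - 1) * (d * X + a' * Y) = a' * |s - s'| ^ 2 * S := by
    rw [mul_add, ex, ey]; ring
  have hdpos : 0 < d ^ (p - 1) := by positivity
  have lower : c₁ * (a' * |s - s'| ^ 2 * S) ≤ d ^ (p - 1) *
      (d * bregman p s (a' * (s - s') / d) + a' * bregman p s (s' - s)) := by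
    rw [← hS]
    calc c₁ * (d ^ (p - 1) * (d * X + a' * Y))
        = d ^ (p - 1) * (d * (c₁ * X) + a' * (c₁ * Y)) := by ring
      _ ≤ _ := by gcongr
  have upper : d ^ (p - 1) *
      (d * bregman p s (a' * (s - s') / d) + a' * bregman p s (s' - s)) ≤
      C₁ * (a' * |s - s'| ^ 2 * S) := by
    rw [← hS]
    calc _ ≤ d ^ (p - 1) * (d * (C₁ * X) + a' * (C₁ * Y)) := by gcongr
      _ = _ := by ring
  -- `M` is the base from the merged divergences, `N` that of the simplified energy; they agree up
  -- to a factor `2`.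
  set M := d * s + (a' + d) * |s - s'| with hM
  set N := √((a' + d) * a') * |s - s'| + |d| * (s + s') with hN
  have hMpos : 0 < M := by positivity
  have hsq1 : √((a' + d) * a') ≤ a' + d :=
    Real.sqrt_le_iff.2 ⟨by positivity, by nlinarith⟩
  have hsq2 : a' ≤ √((a' + d) * a') := Real.le_sqrt_of_sq_le (by nlinarith)
  have hNpos : 0 < N := by positivity
  have hss1 : s' ≤ s + |s - s'| := by linarith [neg_abs_le (s - s')]
  have hss2 : |s - s'| ≤ s + s' := abs_sub_le_iff.2 ⟨by linarith, by linarith⟩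
  have hNM : N ≤ 2 * M := by
    rw [hN, hM, abs_of_pos hd]
    linarith [mul_le_mul_of_nonneg_right hsq1 hδ.le, mul_le_mul_of_nonneg_left hss1 hd.le,
      mul_pos ha' hδ]
  have hMN : M ≤ 2 * N := by
    rw [hN, hM, abs_of_pos hd]
    linarith [mul_le_mul_of_nonneg_right hsq2 hδ.le, mul_le_mul_of_nonneg_left hss2 hd.le,
      mul_nonneg hd.le hs', mul_nonneg (Real.sqrt_nonneg ((a' + d) * a')) hδ.le]
  have q1 : M ^ (p - 2) ≤ D * N ^ (p - 2) := rpow_le_of_comparable _ hMpos hNpos hMN hNM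
  have q2 : N ^ (p - 2) ≤ D * M ^ (p - 2) := rpow_le_of_comparable _ hNpos hMpos hNM hMN
  have hE : simplified p (a' + d) a' s s' = (a' + d) * a' * |s - s'| ^ 2 * N ^ (p - 2) := by
    rw [simplified, add_sub_cancel_left, sq_abs]
  rw [hE]
  constructor
  · refine le_trans ?_ lower
    calc c₁ * c₂ / D * ((a' + d) * a' * |s - s'| ^ 2 * N ^ (p - 2))
        ≤ c₁ * c₂ / D * ((a' + d) * a' * |s - s'| ^ 2 * (D * M ^ (p - 2))) := by gcongr
      _ = c₁ * (a' * |s - s'| ^ 2 * (c₂ * ((a' + d) * M ^ (p - 2)))) := by field_simp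
      _ ≤ _ := by gcongr
  · refine upper.trans ?_
    calc C₁ * (a' * |s - s'| ^ 2 * S)
        ≤ C₁ * (a' * |s - s'| ^ 2 * (C₂ * ((a' + d) * M ^ (p - 2)))) := by gcongr
      _ ≤ C₁ * (a' * |s - s'| ^ 2 * (C₂ * ((a' + d) * (D * N ^ (p - 2))))) := by gcongr
      _ = _ := by ring

/-! ### Transfer of the simplified energy from one edge to another. -/

/-- Monotonicity of `A² (A + B)^q` in `A`. -/
theorem sq_mul_rpow_mono {q A A' B : ℝ} (hq : -2 ≤ q) (hA : 0 ≤ A) (hAA : A ≤ A')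
    (hB : 0 ≤ B) : A ^ 2 * (A + B) ^ q ≤ A' ^ 2 * (A' + B) ^ q := by
  rcases hA.eq_or_lt with rfl | hA
  · have : 0 ≤ A' ^ 2 * (A' + B) ^ q := by positivity
    simpa using this
  have hA' : 0 < A' := hA.trans_le hAA
  -- In this factorization both factors increase with `x`, even for negative `q ≥ -2`.
  have key : ∀ x : ℝ, 0 < x → x ^ 2 * (x + B) ^ q = (x / (x + B)) ^ 2 * (x + B) ^ (q + 2) := by
    intro x hx
    have : 0 < x + B := by positivity
    rw [Real.rpow_add this, Real.rpow_two]
    field_simp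
  rw [key A hA, key A' hA']
  have h1 : A / (A + B) ≤ A' / (A' + B) := by
    rw [div_le_div_iff₀ (by positivity) (by positivity)]
    nlinarith
  have h2 : (A + B) ^ (q + 2) ≤ (A' + B) ^ (q + 2) :=
    Real.rpow_le_rpow (by positivity) (by linarith) (by linarith)
  gcongr

theorem simplified_eq {p a a' : ℝ} (s s' : ℝ) (ha : 0 < a) (ha' : 0 < a') :
    simplified p a a' s s' = (√(a * a') * |s - s'|) ^ 2 *
      (√(a * a') * |s - s'| + |a - a'| * (s + s')) ^ (p - 2) := by
  rw [simplified, mul_pow, Real.sq_sqrt (by positivity), sq_abs]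

theorem simplified_nonneg {p a a' s s' : ℝ} (ha : 0 < a) (ha' : 0 < a') (hs : 0 ≤ s)
    (hs' : 0 ≤ s') : 0 ≤ simplified p a a' s s' := by
  unfold simplified; positivity

/-- As `b = (b^(1/p))^2 (b^(1/p))^(p-2)`, the edge weight can be absorbed into the product and the
gradient term, in the form in which the hypotheses of the theorem compare them. -/
theorem mul_simplified_eq {p a a' b s s' : ℝ} (hp : 1 < p) (ha : 0 < a) (ha' : 0 < a')
    (hs : 0 ≤ s) (hs' : 0 ≤ s') (hb : 0 < b) :
    b * simplified p a a' s s' = (b ^ (1 / p) * √(a * a') * |s - s'|) ^ 2 *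
      (b ^ (1 / p) * √(a * a') * |s - s'| + b ^ (1 / p) * |a - a'| * (s + s')) ^ (p - 2) := by
  have hβ : 0 < b ^ (1 / p) := by positivity
  have h1 : b = (b ^ (1 / p)) ^ 2 * (b ^ (1 / p)) ^ (p - 2) := by
    rw [← Real.rpow_natCast _ 2, ← Real.rpow_add hβ, ← Real.rpow_mul hb.le]
    have : 1 / p * ((2 : ℕ) + (p - 2)) = 1 := by
      push_cast; field_simp; ring
    rw [this, Real.rpow_one]
  rw [simplified_eq s s' ha ha', mul_assoc, mul_assoc (b ^ (1 / p)) |a - a'|, ← mul_add,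
    Real.mul_rpow hβ.le (by positivity), mul_pow]
  nth_rewrite 1 [h1]
  ring

theorem gradWeight_eq {p b : ℝ} (t : ℝ) (hp : 1 < p) (hb : 0 < b) :
    gradWeight p b t = ENNReal.ofReal (b ^ (1 / p) * |t|) ^ (p - 2) := by
  rw [gradWeight, ENNReal.ofReal_mul (by positivity),
    ENNReal.mul_rpow_of_ne_top ENNReal.ofReal_ne_top ENNReal.ofReal_ne_top,
    ← ENNReal.ofReal_rpow_of_pos hb, ← ENNReal.rpow_mul]
  congr 2
  field_simp

theorem le_of_rpow_le {q C x y : ℝ} (hq : 0 < q) (hC : 0 < C) (hy : 0 ≤ y)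
    (h : ENNReal.ofReal x ^ q ≤ ENNReal.ofReal C * ENNReal.ofReal y ^ q) :
    x ≤ C ^ (1 / q) * y := by
  have e : ENNReal.ofReal C * ENNReal.ofReal y ^ q = ENNReal.ofReal (C ^ (1 / q) * y) ^ q := by
    rw [ENNReal.ofReal_mul (by positivity), ENNReal.mul_rpow_of_nonneg _ _ hq.le,
      ← ENNReal.ofReal_rpow_of_pos hC, ← ENNReal.rpow_mul, one_div_mul_cancel hq.ne',
      ENNReal.rpow_one]
  rw [e, ENNReal.rpow_le_rpow_iff hq] at h
  exact (ENNReal.ofReal_le_ofReal_iff (by positivity)).1 h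

theorem le_of_rpow_neg_le {q C x y : ℝ} (hq : q < 0) (hC : 0 < C) (hx : 0 ≤ x)
    (h : ENNReal.ofReal x ^ q ≤ ENNReal.ofReal C * ENNReal.ofReal y ^ q) :
    y ≤ C ^ (1 / -q) * x := by
  refine le_of_rpow_le (neg_pos.2 hq) hC hx ?_
  have hC0 : ENNReal.ofReal C ≠ 0 := by simpa using hC
  have hCt : ENNReal.ofReal C ≠ ∞ := ENNReal.ofReal_ne_top
  rw [ENNReal.rpow_neg, ENNReal.rpow_neg]
  rw [← ENNReal.inv_le_inv, ENNReal.mul_inv (Or.inl hC0) (Or.inl hCt)] at h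
  calc (ENNReal.ofReal y ^ q)⁻¹
      = ENNReal.ofReal C * ((ENNReal.ofReal C)⁻¹ * (ENNReal.ofReal y ^ q)⁻¹) := by
        rw [← mul_assoc, ENNReal.mul_inv_cancel hC0 hCt, one_mul]
    _ ≤ _ := by gcongr

/-- The sign of `q` decides the direction of the bound between `X` and `X'`. For `q < 0`, `A` must
first be enlarged to `√C A'` by monotonicity of the whole product, since the power alone decreases
in `A`. -/
theorem sq_mul_rpow_comparison {q C : ℝ} (hq : -2 ≤ q) (hC : 0 < C) :
    ∃ K > 0, ∀ A A' X X' σ : ℝ, 0 ≤ A → 0 < A' → 0 ≤ X → 0 ≤ X' → 0 ≤ σ → A ^ 2 ≤ C * A' ^ 2 →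
      ENNReal.ofReal X ^ q ≤ ENNReal.ofReal C * ENNReal.ofReal X' ^ q →
      A ^ 2 * (A + X * σ) ^ q ≤ K * (A' ^ 2 * (A' + X' * σ) ^ q) := by
  rcases lt_trichotomy q 0 with hq0 | rfl | hq0
  · set L := C ^ (1 / -q)
    have hL : 0 < L := by positivity
    set κ := min √C (1 / L)
    have hκ : 0 < κ := by positivity
    refine ⟨C * κ ^ q, by positivity, fun A A' X X' σ hA hA' hX hX' hσ hAA h => ?_⟩
    have hXX : X' ≤ L * X := le_of_rpow_neg_le hq0 hC hX h
    have hA1 : A ≤ √C * A' := by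
      refine abs_le_of_sq_le_sq' ?_ (by positivity) |>.2
      rwa [mul_pow, Real.sq_sqrt hC.le]
    have hbase : κ * (A' + X' * σ) ≤ √C * A' + X * σ := by
      have h1 : κ * A' ≤ √C * A' := by gcongr; exact min_le_left _ _
      have h2 : κ * X' ≤ X := calc
        κ * X' ≤ 1 / L * (L * X) := by gcongr; exact min_le_right _ _
        _ = X := by field_simp
      nlinarith [mul_le_mul_of_nonneg_right h2 hσ]
    calc A ^ 2 * (A + X * σ) ^ q
        ≤ (√C * A') ^ 2 * (√C * A' + X * σ) ^ q :=
          sq_mul_rpow_mono hq hA hA1 (by positivity)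
      _ ≤ (√C * A') ^ 2 * (κ * (A' + X' * σ)) ^ q := by
          refine mul_le_mul_of_nonneg_left ?_ (by positivity)
          exact Real.rpow_le_rpow_of_nonpos (by positivity) hbase hq0.le
      _ = _ := by
          rw [Real.mul_rpow hκ.le (by positivity), mul_pow, Real.sq_sqrt hC.le]; ring
  · refine ⟨C, hC, fun A A' X X' σ hA hA' hX hX' hσ hAA h => ?_⟩
    simpa using hAA
  · set L := C ^ (1 / q)
    have hL : 0 < L := by positivity
    set κ := max √C L
    have hκ : 0 < κ := by positivity
    refine ⟨C * κ ^ q, by positivity, fun A A' X X' σ hA hA' hX hX' hσ hAA h => ?_⟩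
    have hXX : X ≤ L * X' := le_of_rpow_le hq0 hC hX' h
    have hA1 : A ≤ √C * A' := by
      refine abs_le_of_sq_le_sq' ?_ (by positivity) |>.2
      rwa [mul_pow, Real.sq_sqrt hC.le]
    have hbase : A + X * σ ≤ κ * (A' + X' * σ) := by
      have h1 : A ≤ κ * A' := hA1.trans (by gcongr; exact le_max_left _ _)
      have h2 : X ≤ κ * X' := hXX.trans (by gcongr; exact le_max_right _ _)
      nlinarith [mul_le_mul_of_nonneg_right h2 hσ]
    calc A ^ 2 * (A + X * σ) ^ q
        ≤ C * A' ^ 2 * (κ * (A' + X' * σ)) ^ q := by gcongr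
      _ = _ := by rw [Real.mul_rpow hκ.le (by positivity)]; ring

/-- Comparison of the simplified energies of two edges. -/
theorem simplified_comparison {p C : ℝ} (hp : 1 < p) (hC : 0 < C) :
    ∃ K > 0, ∀ a a' α α' b b' s s' : ℝ, 0 < a → 0 < a' → 0 < α → 0 < α' → 0 < b → 0 ≤ b' →
      0 ≤ s → 0 ≤ s' → b ^ (2 / p) * (a * a') ≤ C * (b' ^ (2 / p) * (α * α')) →
      gradWeight p b (a - a') ≤ ENNReal.ofReal C * gradWeight p b' (α - α') →
      b * simplified p a a' s s' ≤ K * (b' * simplified p α α' s s') := by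
  obtain ⟨K, hK, H⟩ := sq_mul_rpow_comparison (q := p - 2) (by linarith) hC
  refine ⟨K, hK, fun a a' α α' b b' s s' ha ha' hα hα' hb hb' hs hs' h1 h2 => ?_⟩
  -- An edge of the first graph with positive endpoint values must also be an edge of the second, by
  -- the product condition.
  have hb' : 0 < b' := by
    refine hb'.lt_of_ne' fun h0 => ?_
    rw [h0, Real.zero_rpow (by positivity), zero_mul, mul_zero] at h1
    have : 0 < b ^ (2 / p) * (a * a') := by positivity
    linarith
  by_cases hss : s = s'
  · simp [simplified, hss]
  have hδ : 0 < |s - s'| := abs_pos.2 (sub_ne_zero.2 hss)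
  rw [mul_simplified_eq hp ha ha' hs hs' hb, mul_simplified_eq hp hα hα' hs hs' hb']
  rw [gradWeight_eq _ hp hb, gradWeight_eq _ hp hb'] at h2
  refine H _ _ _ _ _ (by positivity) (by positivity) (by positivity) (by positivity)
    (by positivity) ?_ h2
  have e : ∀ β γ γ' : ℝ, 0 < β → 0 < γ → 0 < γ' →
      (β ^ (1 / p) * √(γ * γ') * |s - s'|) ^ 2 = β ^ (2 / p) * (γ * γ') * |s - s'| ^ 2 := by
    intro β γ γ' hβ hγ hγ'
    rw [mul_pow, mul_pow, Real.sq_sqrt (by positivity), ← Real.rpow_mul_natCast hβ.le]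
    congr 3
    push_cast; ring
  rw [e b a a' hb ha ha', e b' α α' hb' hα hα']
  calc _ ≤ C * (b' ^ (2 / p) * (α * α')) * |s - s'| ^ 2 := by gcongr
    _ = _ := by ring

/-! ### Vanishing remainders force equal limits at the two endpoints. -/

theorem simplified_lower {p a a' L ε : ℝ} (hp : 1 < p) (ha : 0 < a) (ha' : 0 < a') (hL : 0 ≤ L)
    (hε : 0 < ε) : ∃ η > 0, ∀ s s' : ℝ, 0 ≤ s → s ≤ L → 0 ≤ s' → ε ≤ |s - s'| →
      η ≤ simplified p a a' s s' := by
  set k := √(a * a') with hk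
  have hkpos : 0 < k := by positivity
  rcases le_total 0 (p - 2) with hq | hq
  · refine ⟨(k * ε) ^ 2 * (k * ε) ^ (p - 2), by positivity, fun s s' hs hsL hs' h => ?_⟩
    rw [simplified_eq s s' ha ha', ← hk]
    gcongr
    have : k * ε ≤ k * |s - s'| := by gcongr
    have : 0 ≤ |a - a'| * (s + s') := by positivity
    linarith
  · set d := |a - a'|
    have hd : 0 ≤ d := abs_nonneg _
    refine ⟨(1 + d / k) ^ (p - 2) * ((k * ε) ^ 2 * (k * ε + 2 * d * L) ^ (p - 2)),
      by positivity, fun s s' hs hsL hs' h => ?_⟩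
    have hδ : 0 < |s - s'| := hε.trans_le h
    rw [simplified_eq s s' ha ha', ← hk]
    have hss : s' ≤ s + |s - s'| := by linarith [neg_abs_le (s - s')]
    -- For `p < 2` the base needs an upper bound. Only `s` is bounded, so `s'` is replaced by `s +
    -- |s - s'|` and the excess absorbed in `1 + d / k`, leaving an expression monotone in `|s -
    -- s'|`.
    have hbase : k * |s - s'| + d * (s + s') ≤
        (1 + d / k) * (k * |s - s'| + 2 * d * L) := by
      have e : (1 + d / k) * (k * |s - s'| + 2 * d * L) =
          k * |s - s'| + d * |s - s'| + 2 * d * L + d / k * (2 * d * L) := by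
        field_simp
        ring
      have : 0 ≤ d / k * (2 * d * L) := by positivity
      have : d * (s + s') ≤ d * (2 * L + |s - s'|) :=
        mul_le_mul_of_nonneg_left (by linarith) hd
      linarith
    calc (1 + d / k) ^ (p - 2) * ((k * ε) ^ 2 * (k * ε + 2 * d * L) ^ (p - 2))
        ≤ (1 + d / k) ^ (p - 2) *
          ((k * |s - s'|) ^ 2 * (k * |s - s'| + 2 * d * L) ^ (p - 2)) := by
          refine mul_le_mul_of_nonneg_left ?_ (by positivity)
          exact sq_mul_rpow_mono (by linarith) (by positivity) (by gcongr) (by positivity)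
      _ = (k * |s - s'|) ^ 2 * ((1 + d / k) * (k * |s - s'| + 2 * d * L)) ^ (p - 2) := by
          rw [Real.mul_rpow (by positivity) (by positivity)]; ring
      _ ≤ _ := by
          refine mul_le_mul_of_nonneg_left ?_ (by positivity)
          exact Real.rpow_le_rpow_of_nonpos (by positivity) hbase hq

theorem tendsto_of_simplified {p a a' c : ℝ} (hp : 1 < p) (ha : 0 < a) (ha' : 0 < a')
    {χ χ' : ℕ → ℝ} (hχ : ∀ n, 0 ≤ χ n) (hχ' : ∀ n, 0 ≤ χ' n) (hlim : Tendsto χ atTop (𝓝 c))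
    (h : Tendsto (fun n => simplified p a a' (χ n) (χ' n)) atTop (𝓝 0)) :
    Tendsto χ' atTop (𝓝 c) := by
  have hc : 0 ≤ c := ge_of_tendsto' hlim hχ
  have key : Tendsto (fun n => χ n - χ' n) atTop (𝓝 0) := by
    rw [Metric.tendsto_atTop']
    intro ε hε
    obtain ⟨η, hη, H⟩ := simplified_lower (L := c + 1) hp ha ha' (by linarith) hε
    have h1 : ∀ᶠ n in atTop, χ n < c + 1 := hlim.eventually (gt_mem_nhds (by linarith))
    have h2 := h.eventually (gt_mem_nhds hη)
    obtain ⟨N, hN⟩ := eventually_atTop.1 (h1.and h2)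
    refine ⟨N, fun n hn => ?_⟩
    obtain ⟨l1, l2⟩ := hN n hn.le
    rw [Real.dist_eq, sub_zero]
    by_contra hcon
    exact absurd (H _ _ (hχ n) l1.le (hχ' n) (not_lt.1 hcon)) (not_le.2 l2)
  simpa using hlim.sub key

theorem tendsto_of_picone {p a a' c : ℝ} (hp : 1 < p) (ha : 0 < a) (ha' : 0 < a')
    {χ χ' : ℕ → ℝ} (hχ : ∀ n, 0 ≤ χ n) (hχ' : ∀ n, 0 ≤ χ' n) (hlim : Tendsto χ atTop (𝓝 c))
    (h : Tendsto (fun n => picone p a a' (χ n) (χ' n)) atTop (𝓝 0)) :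
    Tendsto χ' atTop (𝓝 c) := by
  obtain ⟨k, hk, K, hK, H⟩ := picone_bounds hp
  refine tendsto_of_simplified hp ha ha' hχ hχ' hlim ?_
  have h2 : Tendsto (fun n => k⁻¹ * picone p a a' (χ n) (χ' n)) atTop (𝓝 0) := by
    simpa using h.const_mul k⁻¹
  refine squeeze_zero (fun n => simplified_nonneg ha ha' (hχ n) (hχ' n)) (fun n => ?_) h2
  rw [inv_mul_eq_div, le_div_iff₀ hk, mul_comm]
  exact (H a a' _ _ ha ha' (hχ n) (hχ' n)).1

/-! ### The ground state representation. -/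

variable {X : Type*}

theorem spow_abs {p : ℝ} (t : ℝ) (hp : 1 < p) : |spow t (p - 1)| = |t| ^ (p - 1) := by
  unfold spow
  rw [abs_mul, abs_of_nonneg (by positivity : (0 : ℝ) ≤ |t| ^ (p - 1 - 1))]
  rcases (abs_nonneg t).eq_or_lt with h | h
  · rw [← h, zero_mul, Real.zero_rpow (by linarith)]
  · rw [mul_comm, ← Real.rpow_add_one h.ne']; congr 1; ring

theorem mul_spow_self {p : ℝ} (t : ℝ) (hp : 1 < p) : t * spow t (p - 1) = |t| ^ p := by
  unfold spow
  rcases (abs_nonneg t).eq_or_lt with h | h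
  · rw [abs_eq_zero.1 h.symm, abs_zero, zero_mul, Real.zero_rpow (by linarith)]
  · rw [← mul_assoc, ← abs_mul_abs_self, mul_assoc, mul_comm, mul_comm |t| (|t| ^ _),
      ← Real.rpow_add_one h.ne', ← Real.rpow_add_one h.ne']
    congr 1; ring

theorem InDomain.summable_spow {p : ℝ} {Γ : WeightedGraph X} {f : X → ℝ} (hp : 1 < p)
    (hf : InDomain p Γ f) (x : X) : Summable fun y => Γ.b x y * spow (f x - f y) (p - 1) := by
  refine Summable.of_abs ((hf x).congr fun y => ?_)
  rw [abs_mul, spow_abs _ hp, abs_of_nonneg (Γ.nonneg x y)]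

theorem hasSum_fst_mul {F : X → X → ℝ} (hF : ∀ x, Summable (F x)) {η : X → ℝ} {S : Finset X}
    (hη : ∀ x ∉ S, η x = 0) :
    HasSum (fun z : X × X => η z.1 * F z.1 z.2) (∑ x ∈ S, η x * ∑' y, F x y) := by
  classical
  have h1 : ∀ x ∈ S, HasSum (fun z : X × X => if z.1 = x then η x * F x z.2 else 0)
      (η x * ∑' y, F x y) := by
    intro x _
    have hinj : Function.Injective fun y : X => (x, y) := fun y y' h => (Prod.mk.inj h).2
    rw [← hinj.hasSum_iff]
    · simpa [Function.comp_def] using (hF x).hasSum.mul_left (η x)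
    · rintro ⟨z1, z2⟩ hz
      rw [if_neg]
      rintro rfl
      exact hz ⟨z2, rfl⟩
  convert hasSum_sum h1 using 2 with z
  rw [Finset.sum_ite_eq S z.1]
  split_ifs with hz
  · rfl
  · rw [hη _ hz, zero_mul]

/-- Discrete Green's formula: antisymmetry turns the difference into a sum of two terms exchanged by
swapping coordinates. Finite support of `η` and summability at each vertex replace local finiteness.
-/
theorem hasSum_antisymm_mul {F : X → X → ℝ} (hF : ∀ x, Summable (F x))
    (hanti : ∀ x y, F x y = -F y x) {η : X → ℝ} {S : Finset X} (hη : ∀ x ∉ S, η x = 0) :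
    HasSum (fun z : X × X => F z.1 z.2 * (η z.1 - η z.2))
      (2 * ∑ x ∈ S, η x * ∑' y, F x y) := by
  have h1 := hasSum_fst_mul hF hη
  have h2 := (Equiv.prodComm X X).hasSum_iff.2 h1
  convert h1.add h2 using 1
  · ext z
    simp only [Function.comp_def, Equiv.prodComm_apply, Prod.fst_swap, Prod.snd_swap]
    rw [hanti z.2 z.1]
    ring
  · ring

theorem summable_gradient {p : ℝ} (hp : 1 < p) (Γ : WeightedGraph X) {φ : X → ℝ} {S : Finset X}
    (hφ : ∀ x ∉ S, φ x = 0) :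
    Summable fun z : X × X => Γ.b z.1 z.2 * |φ z.1 - φ z.2| ^ p := by
  have hη : ∀ x ∉ S, |φ x| ^ p = 0 := fun x hx => by
    rw [hφ x hx, abs_zero, Real.zero_rpow (by linarith)]
  have h1 := (hasSum_fst_mul (F := Γ.b) Γ.summable hη).summable
  have h2 := (Equiv.prodComm X X).summable_iff.2 h1
  refine Summable.of_nonneg_of_le (fun z => mul_nonneg (Γ.nonneg _ _) (by positivity))
    (fun z => ?_) ((h1.add h2).mul_left (2 ^ p))
  simp only [Function.comp_def, Equiv.prodComm_apply, Prod.fst_swap, Prod.snd_swap]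
  rw [Γ.symm z.2 z.1, ← add_mul, ← mul_assoc, mul_comm]
  refine mul_le_mul_of_nonneg_right ?_ (Γ.nonneg _ _)
  have h3 : |φ z.1 - φ z.2| ≤ 2 * max |φ z.1| |φ z.2| := by
    have := abs_sub (φ z.1) (φ z.2)
    linarith [le_max_left |φ z.1| |φ z.2|, le_max_right |φ z.1| |φ z.2|]
  calc |φ z.1 - φ z.2| ^ p ≤ (2 * max |φ z.1| |φ z.2|) ^ p := by gcongr
    _ = 2 ^ p * (max |φ z.1| |φ z.2|) ^ p := Real.mul_rpow (by norm_num) (by positivity)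
    _ ≤ 2 ^ p * (|φ z.1| ^ p + |φ z.2| ^ p) := by
      gcongr
      have ha : 0 ≤ |φ z.1| ^ p := by positivity
      have hb : 0 ≤ |φ z.2| ^ p := by positivity
      rcases max_choice |φ z.1| |φ z.2| with h | h <;> rw [h] <;> linarith

/-- The Picone remainder of an edge, for functions `w` and `ψ`. -/
def edgePicone (p : ℝ) (Γ : WeightedGraph X) (w ψ : X → ℝ) (z : X × X) : ℝ :=
  Γ.b z.1 z.2 * picone p (w z.1) (w z.2) (ψ z.1) (ψ z.2)

/-- The ground state representation of the energy. -/
theorem energy_mul_eq {p : ℝ} (hp : 1 < p) {Γ : WeightedGraph X} {m : X → ℝ}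
    (hm : ∀ x, 0 < m x) (V : X → ℝ) {w ψ : X → ℝ} (hw : InDomain p Γ w)
    (hψ0 : ∀ x, 0 ≤ ψ x) {S : Finset X} (hψ : ∀ x ∉ S, ψ x = 0) :
    Summable (edgePicone p Γ w ψ) ∧ energy p Γ m V (fun x => w x * ψ x) =
      (1 / 2) * ∑' z, edgePicone p Γ w ψ z +
        ∑ x ∈ S, m x * (w x * ψ x ^ p) * schrodinger p Γ m V w x := by
  have hp0 : p ≠ 0 := by linarith
  have h1 := summable_gradient hp Γ (φ := fun x => w x * ψ x) (S := S)
    (fun x hx => by rw [hψ x hx, mul_zero])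
  -- Green's formula for the flux of `w`, tested with `w ψ^p`; what remains of the energy density is
  -- the Picone remainder.
  have h2 := hasSum_antisymm_mul (F := fun x y => Γ.b x y * spow (w x - w y) (p - 1))
    (fun x => hw.summable_spow hp x)
    (fun x y => by rw [Γ.symm, spow, spow, abs_sub_comm]; ring)
    (η := fun x => w x * ψ x ^ p) (S := S)
    (fun x hx => by simp only [hψ x hx, Real.zero_rpow hp0, mul_zero])
  have h3 := h1.hasSum.sub h2
  have h4 : edgePicone p Γ w ψ = fun z => Γ.b z.1 z.2 * |w z.1 * ψ z.1 - w z.2 * ψ z.2| ^ p -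
      Γ.b z.1 z.2 * spow (w z.1 - w z.2) (p - 1) * (w z.1 * ψ z.1 ^ p - w z.2 * ψ z.2 ^ p) := by
    ext z
    unfold edgePicone picone
    ring
  rw [← h4] at h3
  refine ⟨h3.summable, ?_⟩
  rw [h3.tsum_eq, energy, tsum_eq_sum (s := S)
    (fun x hx => by rw [hψ x hx, mul_zero, abs_zero, Real.zero_rpow hp0, mul_zero])]
  have h5 : ∑ x ∈ S, m x * (w x * ψ x ^ p) * schrodinger p Γ m V w x =
      ∑ x ∈ S, w x * ψ x ^ p * ∑' y, Γ.b x y * spow (w x - w y) (p - 1) +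
        ∑ x ∈ S, m x * V x * |w x * ψ x| ^ p := by
    rw [← Finset.sum_add_distrib]
    refine Finset.sum_congr rfl fun x _ => ?_
    have := (hm x).ne'
    rw [abs_mul, Real.mul_rpow (abs_nonneg _) (abs_nonneg _), ← mul_spow_self (w x) hp,
      abs_of_nonneg (hψ0 x), schrodinger, pLaplacian]
    field_simp
  rw [h5]
  ring

/-! ### Null sequences of a critical operator. -/

theorem energy_abs_le {p : ℝ} (hp : 1 < p) (Γ : WeightedGraph X) (m V : X → ℝ) {φ : X → ℝ}
    (hφ : φ.support.Finite) : energy p Γ m V (fun x => |φ x|) ≤ energy p Γ m V φ := by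
  have h0 : ∀ x ∉ hφ.toFinset, φ x = 0 := fun x hx => by simpa using hx
  have h1 := Summable.tsum_le_tsum (fun z : X × X => mul_le_mul_of_nonneg_left
    (Real.rpow_le_rpow (abs_nonneg _) (abs_abs_sub_abs_le (φ z.1) (φ z.2))
      (by linarith : 0 ≤ p)) (Γ.nonneg z.1 z.2))
    (summable_gradient hp Γ (φ := fun x => |φ x|) (fun x hx => by rw [h0 x hx, abs_zero]))
    (summable_gradient hp Γ h0)
  unfold energy
  simp only [abs_abs]
  linarith

theorem energy_smul {p : ℝ} (Γ : WeightedGraph X) (m V : X → ℝ) (φ : X → ℝ) {t : ℝ}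
    (ht : 0 ≤ t) : energy p Γ m V (fun x => t * φ x) = t ^ p * energy p Γ m V φ := by
  unfold energy
  have h1 : ∀ z : X × X, Γ.b z.1 z.2 * |t * φ z.1 - t * φ z.2| ^ p =
      t ^ p * (Γ.b z.1 z.2 * |φ z.1 - φ z.2| ^ p) := fun z => by
    rw [← mul_sub, abs_mul, abs_of_nonneg ht, Real.mul_rpow ht (abs_nonneg _)]; ring
  have h2 : ∀ x, m x * V x * |t * φ x| ^ p = t ^ p * (m x * V x * |φ x| ^ p) := fun x => by
    rw [abs_mul, abs_of_nonneg ht, Real.mul_rpow ht (abs_nonneg _)]; ring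
  simp_rw [h1, h2, tsum_mul_left]
  ring

/-- Criticality yields finitely supported functions of small energy, normalized at a point. -/
theorem Critical.exists_small_energy {p : ℝ} (hp : 1 < p) {Γ : WeightedGraph X} {m V : X → ℝ}
    (hm : ∀ x, 0 < m x) (hc : Critical p Γ m V) (o : X) {ε : ℝ} (hε : 0 < ε) :
    ∃ φ : X → ℝ, φ.support.Finite ∧ (∀ x, 0 ≤ φ x) ∧ φ o = 1 ∧ energy p Γ m V φ ≤ ε := by
  classical
  have hp0 : p ≠ 0 := by linarith
  -- This point perturbation lowers the energy by exactly `ε |φ o|^p`. A negative perturbed energy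
  -- thus forces `φ o ≠ 0` and allows normalization.
  set W : X → ℝ := fun x => if x = o then ε / m o else 0 with hW
  have hWpos : Positive W := by
    refine ⟨fun x => ?_, fun h => ?_⟩
    · have := hm o
      simp only [hW, Pi.zero_apply]
      split_ifs <;> positivity
    · have h := congrFun h o
      simp only [hW, if_true, Pi.zero_apply] at h
      exact (div_pos hε (hm o)).ne' h
  have h := hc.2 W hWpos
  unfold EnergyNonneg at h
  push Not at h
  obtain ⟨φ, hφ, hneg⟩ := h
  have h0 : ∀ x ∉ insert o hφ.toFinset, φ x = 0 := fun x hx => by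
    simp only [Finset.mem_insert, not_or] at hx
    simpa using hx.2
  have e : energy p Γ m (V - W) φ = energy p Γ m V φ - ε * |φ o| ^ p := by
    unfold energy
    have hz : ∀ U : X → ℝ, ∑' x, m x * U x * |φ x| ^ p =
        ∑ x ∈ insert o hφ.toFinset, m x * U x * |φ x| ^ p := fun U =>
      tsum_eq_sum fun x hx => by rw [h0 x hx, abs_zero, Real.zero_rpow hp0, mul_zero]
    rw [hz, hz, add_sub_assoc]
    congr 1
    have : ∑ x ∈ insert o hφ.toFinset, m x * W x * |φ x| ^ p = ε * |φ o| ^ p := by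
      rw [Finset.sum_eq_single o]
      · have := (hm o).ne'
        simp only [hW, if_true]
        field_simp
      · intro x _ hx
        simp [hW, hx]
      · simp
    rw [← this, ← Finset.sum_sub_distrib]
    refine Finset.sum_congr rfl fun x _ => ?_
    rw [Pi.sub_apply]; ring
  have hEabs : energy p Γ m V (fun x => |φ x|) < ε * |φ o| ^ p := by
    have := energy_abs_le hp Γ m V hφ
    linarith
  have hsupp : (fun x => |φ x|).support = φ.support := by ext x; simp
  have hne : φ o ≠ 0 := by
    intro h
    rw [h, abs_zero, Real.zero_rpow hp0, mul_zero] at hEabs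
    have := hc.1 _ (hsupp ▸ hφ)
    linarith
  have hpos : 0 < |φ o| := abs_pos.2 hne
  refine ⟨fun x => |φ o|⁻¹ * |φ x|, ?_, fun x => by positivity, by field_simp, ?_⟩
  · refine hφ.subset fun x hx => ?_
    simp only [Function.mem_support] at hx ⊢
    exact fun h => hx (by simp [h])
  · rw [energy_smul Γ m V _ (inv_nonneg.2 hpos.le), Real.inv_rpow hpos.le, inv_mul_eq_div,
      div_le_iff₀ (by positivity)]
    exact hEabs.le

/-! ### Signed powers, homogeneity and the minimum principle. -/

theorem spow_of_nonneg {p t : ℝ} (hp : 1 < p) (ht : 0 ≤ t) : spow t (p - 1) = t ^ (p - 1) := by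
  have h := spow_abs t hp
  rwa [abs_of_nonneg ht, abs_of_nonneg] at h
  unfold spow; positivity

theorem spow_neg (t r : ℝ) : spow (-t) r = -spow t r := by
  unfold spow; rw [abs_neg, neg_mul]

theorem spow_mono {p : ℝ} (hp : 1 < p) {s t : ℝ} (hst : s ≤ t) :
    spow s (p - 1) ≤ spow t (p - 1) := by
  have key : ∀ {s t : ℝ}, 0 ≤ s → s ≤ t → spow s (p - 1) ≤ spow t (p - 1) := by
    intro s t hs hst
    rw [spow_of_nonneg hp hs, spow_of_nonneg hp (hs.trans hst)]
    exact Real.rpow_le_rpow hs hst (by linarith)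
  have hnn : ∀ {t : ℝ}, 0 ≤ t → 0 ≤ spow t (p - 1) := by
    intro t ht; unfold spow; positivity
  rcases le_total 0 s with hs | hs
  · exact key hs hst
  · rcases le_total 0 t with ht | ht
    · have h := hnn (neg_nonneg.2 hs)
      rw [spow_neg] at h
      linarith [hnn ht]
    · have h := key (neg_nonneg.2 ht) (neg_le_neg hst)
      rw [spow_neg, spow_neg] at h
      linarith

theorem spow_mul {p l : ℝ} (t : ℝ) (hp : 1 < p) (hl : 0 ≤ l) :
    spow (l * t) (p - 1) = l ^ (p - 1) * spow t (p - 1) := by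
  rw [← spow_of_nonneg hp hl]
  unfold spow
  rw [abs_mul, Real.mul_rpow (abs_nonneg _) (abs_nonneg _)]
  ring

theorem InDomain.smul {p l : ℝ} {Γ : WeightedGraph X} {f : X → ℝ} (hl : 0 ≤ l)
    (hf : InDomain p Γ f) : InDomain p Γ fun x => l * f x := fun x => by
  refine ((hf x).mul_left (l ^ (p - 1))).congr fun y => ?_
  rw [← mul_sub, abs_mul, abs_of_nonneg hl, Real.mul_rpow hl (abs_nonneg _)]
  ring

theorem schrodinger_smul {p l : ℝ} (Γ : WeightedGraph X) (m V f : X → ℝ) (hp : 1 < p)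
    (hl : 0 ≤ l) (x : X) :
    schrodinger p Γ m V (fun x => l * f x) x = l ^ (p - 1) * schrodinger p Γ m V f x := by
  unfold schrodinger pLaplacian
  simp_rw [← mul_sub, spow_mul _ hp hl, mul_left_comm _ (l ^ (p - 1)), tsum_mul_left]
  ring

/-- The strong minimum principle. -/
theorem Superharmonic.pos {p : ℝ} (hp : 1 < p) {Γ : WeightedGraph X} (hΓ : Γ.Connected)
    {m V w : X → ℝ} (hm : ∀ x, 0 < m x) (hw : Superharmonic p Γ m V w) (hpos : Positive w)
    (x : X) : 0 < w x := by
  have hnn : ∀ x, 0 ≤ w x := hpos.1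
  -- At a zero of `w` the operator is a sum of nonpositive terms that must be nonnegative, so zeros
  -- spread to neighbours.
  have step : ∀ x y, w x = 0 → 0 < Γ.b x y → w y = 0 := by
    intro x y hx hb
    have h := hw.2 x
    have hs : spow (w x) (p - 1) = 0 := by rw [hx, spow, zero_mul]
    rw [schrodinger, hs, mul_zero, add_zero, pLaplacian] at h
    have h1 : 0 ≤ ∑' y, Γ.b x y * spow (w x - w y) (p - 1) :=
      nonneg_of_mul_nonneg_right h (one_div_pos.2 (hm x))
    have hterm : ∀ y, Γ.b x y * spow (w x - w y) (p - 1) = -(Γ.b x y * w y ^ (p - 1)) := by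
      intro y
      rw [hx, zero_sub, spow_neg, spow_of_nonneg hp (hnn y), mul_neg]
    have hsum := hw.1.summable_spow hp x
    simp_rw [hterm] at h1 hsum
    rw [tsum_neg] at h1
    have hnn' : ∀ y, 0 ≤ Γ.b x y * w y ^ (p - 1) := fun y =>
      mul_nonneg (Γ.nonneg x y) (Real.rpow_nonneg (hnn y) _)
    have hle := (summable_neg_iff.1 hsum).le_tsum y fun y' _ => hnn' y'
    have h0 : Γ.b x y * w y ^ (p - 1) = 0 := le_antisymm (by linarith) (hnn' y)
    rcases mul_eq_zero.1 h0 with h | h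
    · exact absurd h hb.ne'
    · exact ((Real.rpow_eq_zero (hnn y) (by linarith)).1 h)
  refine (hnn x).lt_of_ne' fun hx => hpos.2 (funext fun y => ?_)
  have := hΓ x y
  induction this with
  | refl => exact hx
  | tail _ hb ih => exact step _ _ ih hb

/-! ### Pointwise convergence along null sequences. -/

theorem edgePicone_nonneg {p : ℝ} (hp : 1 < p) (Γ : WeightedGraph X) {w ψ : X → ℝ}
    (hw : ∀ x, 0 < w x) (hψ : ∀ x, 0 ≤ ψ x) (z : X × X) : 0 ≤ edgePicone p Γ w ψ z := by
  obtain ⟨c, hc, C, hC, H⟩ := picone_bounds hp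
  refine mul_nonneg (Γ.nonneg _ _) (le_trans ?_ (H _ _ _ _ (hw z.1) (hw z.2) (hψ _) (hψ _)).1)
  exact mul_nonneg hc.le (simplified_nonneg (hw _) (hw _) (hψ _) (hψ _))

/-- The energy controls the Picone remainders with respect to a superharmonic function. -/
theorem tsum_edgePicone_le {p : ℝ} (hp : 1 < p) {Γ : WeightedGraph X} {m V w ψ : X → ℝ}
    (hm : ∀ x, 0 < m x) (hw : Superharmonic p Γ m V w) (hpos : ∀ x, 0 < w x)
    (hψ : ∀ x, 0 ≤ ψ x) {S : Finset X} (hS : ∀ x ∉ S, ψ x = 0) :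
    ∑' z, edgePicone p Γ w ψ z ≤ 2 * energy p Γ m V (fun x => w x * ψ x) := by
  have h := (energy_mul_eq hp hm V hw.1 hψ hS).2
  have : 0 ≤ ∑ x ∈ S, m x * (w x * ψ x ^ p) * schrodinger p Γ m V w x :=
    Finset.sum_nonneg fun x _ => mul_nonneg (mul_nonneg (hm x).le
      (mul_nonneg (hpos x).le (Real.rpow_nonneg (hψ x) _))) (hw.2 x)
  linarith

/-- A single remainder is at most the sum of all of them, hence at most twice the energy. -/
theorem tendsto_edgePicone {p : ℝ} (hp : 1 < p) {Γ : WeightedGraph X} {m V w : X → ℝ}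
    (hm : ∀ x, 0 < m x) (hw : Superharmonic p Γ m V w) (hpos : ∀ x, 0 < w x)
    {χ : ℕ → X → ℝ} (hχ : ∀ n x, 0 ≤ χ n x) {S : ℕ → Finset X} (hS : ∀ n, ∀ x ∉ S n, χ n x = 0)
    {e : ℕ → ℝ} (he : Tendsto e atTop (𝓝 0))
    (hE : ∀ n, energy p Γ m V (fun x => w x * χ n x) ≤ e n) (z : X × X) :
    Tendsto (fun n => edgePicone p Γ w (χ n) z) atTop (𝓝 0) := by
  have he2 : Tendsto (fun n => 2 * e n) atTop (𝓝 0) := by simpa using he.const_mul 2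
  refine squeeze_zero (fun n => edgePicone_nonneg hp Γ hpos (hχ n) z) (fun n => ?_) he2
  have hsum := (energy_mul_eq hp hm V hw.1 (hχ n) (hS n)).1
  have h1 := hsum.le_tsum z fun z' _ => edgePicone_nonneg hp Γ hpos (hχ n) z'
  have h2 := tsum_edgePicone_le hp hm hw hpos (hχ n) (hS n)
  linarith [hE n]

/-- The limit spreads from `o` along a path, one edge at a time. -/
theorem tendsto_of_edgePicone {p : ℝ} (hp : 1 < p) {Γ : WeightedGraph X} (hΓ : Γ.Connected)
    {w : X → ℝ} (hpos : ∀ x, 0 < w x) {χ : ℕ → X → ℝ} (hχ : ∀ n x, 0 ≤ χ n x)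
    (h : ∀ z, Tendsto (fun n => edgePicone p Γ w (χ n) z) atTop (𝓝 0)) {o : X} {c : ℝ}
    (ho : Tendsto (fun n => χ n o) atTop (𝓝 c)) (x : X) :
    Tendsto (fun n => χ n x) atTop (𝓝 c) := by
  have := hΓ o x
  induction this with
  | refl => exact ho
  | @tail y z _ hb ih =>
    refine tendsto_of_picone hp (hpos y) (hpos z) (fun n => hχ n y) (fun n => hχ n z) ih ?_
    have h1 := (h (y, z)).const_mul (Γ.b y z)⁻¹
    rw [mul_zero] at h1
    refine h1.congr fun n => ?_
    rw [edgePicone, inv_mul_cancel_left₀ hb.ne']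

/-! ### The Liouville comparison principle. -/

theorem posPart_inDomain {p : ℝ} (hp : 1 < p) {Γ : WeightedGraph X} {u : X → ℝ}
    (hu : InDomain p Γ u) : InDomain p Γ u⁺ := fun x => by
  refine Summable.of_nonneg_of_le
    (fun y => mul_nonneg (Γ.nonneg x y) (Real.rpow_nonneg (abs_nonneg _) _)) (fun y => ?_) (hu x)
  refine mul_le_mul_of_nonneg_left (Real.rpow_le_rpow (abs_nonneg _) ?_ (by linarith))
    (Γ.nonneg x y)
  exact abs_max_sub_max_le_abs _ _ _

/-- The positive part of a harmonic function is subharmonic where it is positive. -/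
theorem schrodinger_posPart_nonpos {p : ℝ} (hp : 1 < p) {Γ : WeightedGraph X} {m V u : X → ℝ}
    (hm : ∀ x, 0 < m x) (hu : Harmonic p Γ m V u) {x : X} (hx : 0 < u x) :
    schrodinger p Γ m V u⁺ x ≤ 0 := by
  rw [← hu.2 x]
  have e : u⁺ x = u x := max_eq_left hx.le
  unfold schrodinger pLaplacian
  rw [e]
  have hD := (posPart_inDomain hp hu.1).summable_spow hp x
  rw [e] at hD
  refine add_le_add_left (mul_le_mul_of_nonneg_left
    (hD.tsum_le_tsum (fun y => ?_) (hu.1.summable_spow hp x)) (one_div_pos.2 (hm x)).le) _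
  -- At a point where `u > 0`, passing to `u⁺` keeps the value there and can only raise the
  -- neighbours, so every difference decreases.
  refine mul_le_mul_of_nonneg_left (spow_mono hp ?_) (Γ.nonneg x y)
  have : u y ≤ u⁺ y := le_max_left _ _
  linarith

/-- The energy of `u⁺ ψ` is controlled by the Picone remainders of `v`. -/
theorem energy_posPart_mul_le {p C : ℝ} (hp : 1 < p) (hC : 0 < C) {m : X → ℝ}
    (hm : ∀ x, 0 < m x) (Γ Γ' : WeightedGraph X) {V u v : X → ℝ} (hv : ∀ x, 0 < v x)
    (hvD : InDomain p Γ' v) (hu : Harmonic p Γ m V u)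
    (hprod : ∀ x y, 0 < u x → 0 < u y →
      Γ.b x y ^ (2 / p) * (u⁺ x * u⁺ y) ≤ C * (Γ'.b x y ^ (2 / p) * (v x * v y)))
    (hgrad : ∀ x y, 0 < u x → 0 < u y → 0 < Γ.b x y →
      gradWeight p (Γ.b x y) (u⁺ x - u⁺ y) ≤
        ENNReal.ofReal C * gradWeight p (Γ'.b x y) (v x - v y)) :
    ∃ K > 0, ∀ (ψ : X → ℝ) (S : Finset X), (∀ x, 0 ≤ ψ x) → (∀ x ∉ S, ψ x = 0) →
      energy p Γ m V (fun x => u⁺ x * ψ x) ≤ K * ∑' z, edgePicone p Γ' v ψ z := by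
  obtain ⟨c₁, hc₁, C₁, hC₁, H⟩ := picone_bounds hp
  obtain ⟨K, hK, hcomp⟩ := simplified_comparison hp hC
  refine ⟨C₁ * K / c₁, by positivity, fun ψ S hψ hS => ?_⟩
  have hUnn : ∀ x, 0 ≤ u⁺ x := fun x => le_max_right _ _
  obtain ⟨hsU, hEU⟩ := energy_mul_eq hp hm V (posPart_inDomain hp hu.1) hψ hS
  have hsv := (energy_mul_eq hp hm V hvD hψ hS).1
  have hedge : ∀ z, edgePicone p Γ u⁺ ψ z ≤ C₁ * K / c₁ * edgePicone p Γ' v ψ z := by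
    intro z
    have hR : 0 ≤ C₁ * K / c₁ * edgePicone p Γ' v ψ z :=
      mul_nonneg (by positivity) (edgePicone_nonneg hp Γ' hv hψ z)
    rcases (Γ.nonneg z.1 z.2).eq_or_lt with hb | hb
    · rwa [edgePicone, ← hb, zero_mul]
    rcases (hUnn z.1).eq_or_lt with h1 | h1
    · rwa [edgePicone, picone_comm, ← h1, picone_zero_right hp (hUnn _) (hψ _), mul_zero]
    rcases (hUnn z.2).eq_or_lt with h2 | h2
    · rwa [edgePicone, ← h2, picone_zero_right hp (hUnn _) (hψ _), mul_zero]
    have hu1 : 0 < u z.1 := by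
      by_contra h; exact h1.ne' (max_eq_right (not_lt.1 h))
    have hu2 : 0 < u z.2 := by
      by_contra h; exact h2.ne' (max_eq_right (not_lt.1 h))
    have hc := hcomp _ _ _ _ _ _ (ψ z.1) (ψ z.2) h1 h2 (hv z.1) (hv z.2) hb (Γ'.nonneg _ _)
      (hψ _) (hψ _) (hprod _ _ hu1 hu2) (hgrad _ _ hu1 hu2 hb)
    have hb' := Γ'.nonneg z.1 z.2
    unfold edgePicone
    calc Γ.b z.1 z.2 * picone p (u⁺ z.1) (u⁺ z.2) (ψ z.1) (ψ z.2)
        ≤ Γ.b z.1 z.2 * (C₁ * simplified p (u⁺ z.1) (u⁺ z.2) (ψ z.1) (ψ z.2)) :=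
          mul_le_mul_of_nonneg_left (H _ _ _ _ h1 h2 (hψ _) (hψ _)).2 hb.le
      _ = C₁ * (Γ.b z.1 z.2 * simplified p (u⁺ z.1) (u⁺ z.2) (ψ z.1) (ψ z.2)) := by ring
      _ ≤ C₁ * (K * (Γ'.b z.1 z.2 * simplified p (v z.1) (v z.2) (ψ z.1) (ψ z.2))) :=
          mul_le_mul_of_nonneg_left hc hC₁.le
      _ = C₁ * K / c₁ * (Γ'.b z.1 z.2 *
            (c₁ * simplified p (v z.1) (v z.2) (ψ z.1) (ψ z.2))) := by field_simp
      _ ≤ _ := by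
          refine mul_le_mul_of_nonneg_left (mul_le_mul_of_nonneg_left ?_ hb') (by positivity)
          exact (H _ _ _ _ (hv _) (hv _) (hψ _) (hψ _)).1
  have hle := hsU.tsum_le_tsum hedge (hsv.mul_left _)
  rw [tsum_mul_left] at hle
  have hneg : ∑ x ∈ S, m x * (u⁺ x * ψ x ^ p) * schrodinger p Γ m V u⁺ x ≤ 0 := by
    refine Finset.sum_nonpos fun x _ => ?_
    rcases le_or_gt (u x) 0 with h | h
    · have : u⁺ x = 0 := max_eq_right h
      rw [this]; simp
    · exact mul_nonpos_of_nonneg_of_nonpos (mul_nonneg (hm x).le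
        (mul_nonneg (hUnn x) (Real.rpow_nonneg (hψ x) _)))
        (schrodinger_posPart_nonpos hp hm hu h)
  have hnn : 0 ≤ C₁ * K / c₁ * ∑' z, edgePicone p Γ' v ψ z :=
    mul_nonneg (by positivity) (tsum_nonneg fun z => edgePicone_nonneg hp Γ' hv hψ z)
  linarith

/-- The Liouville comparison principle: a harmonic function with nontrivial positive part that is
dominated by the ground state of a critical operator is strictly positive. -/
theorem Harmonic.pos_of_comparison {p C : ℝ} (hp : 1 < p) (hC : 0 < C) {m : X → ℝ}
    (hm : ∀ x, 0 < m x) {Γ Γ' : WeightedGraph X} (hΓ : Γ.Connected) (hΓ' : Γ'.Connected)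
    {V V' u v : X → ℝ} (hH : PositiveOperator p Γ m V) (hv : ∀ x, 0 < v x)
    (hground : AgmonGroundState p Γ' m V' v) (hu : Harmonic p Γ m V u) (hupos : u⁺ ≠ 0)
    (hprod : ∀ x y, 0 < u x → 0 < u y →
      Γ.b x y ^ (2 / p) * (u⁺ x * u⁺ y) ≤ C * (Γ'.b x y ^ (2 / p) * (v x * v y)))
    (hgrad : ∀ x y, 0 < u x → 0 < u y → 0 < Γ.b x y →
      gradWeight p (Γ.b x y) (u⁺ x - u⁺ y) ≤
        ENNReal.ofReal C * gradWeight p (Γ'.b x y) (v x - v y)) (x : X) : 0 < u x := by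
  obtain ⟨hcrit, -, hvs⟩ := hground
  obtain ⟨w, hwpos, hw⟩ := hH
  have hw0 := hw.pos hp hΓ hm hwpos
  have hUnn : ∀ x, 0 ≤ u⁺ x := fun x => le_max_right _ _
  obtain ⟨q, hq⟩ := Function.ne_iff.1 hupos
  have hUq : 0 < u⁺ q := (hUnn q).lt_of_ne' hq
  choose φ hφfin hφ0 hφq hφE using fun n : ℕ =>
    hcrit.exists_small_energy hp hm q (Nat.one_div_pos_of_nat (n := n) (α := ℝ))
  set S : ℕ → Finset X := fun n => (hφfin n).toFinset
  set ψ : ℕ → X → ℝ := fun n x => φ n x / v x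
  have hψ0 : ∀ n x, 0 ≤ ψ n x := fun n x => div_nonneg (hφ0 n x) (hv x).le
  have hψS : ∀ n, ∀ x ∉ S n, ψ n x = 0 := fun n x hx => by
    have : φ n x = 0 := by simpa [S] using hx
    simp [ψ, this]
  have hvψ : ∀ n, (fun x => v x * ψ n x) = φ n := fun n =>
    funext fun x => mul_div_cancel₀ _ (hv x).ne'
  have hEv : ∀ n, energy p Γ' m V' (fun x => v x * ψ n x) ≤ 1 / ((n : ℝ) + 1) := fun n => by
    rw [hvψ]; exact hφE n
  have hψlim : ∀ x, Tendsto (fun n => ψ n x) atTop (𝓝 (1 / v q)) :=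
    tendsto_of_edgePicone hp hΓ' hv hψ0
      (tendsto_edgePicone hp hm hvs hv hψ0 hψS tendsto_one_div_add_atTop_nhds_zero_nat hEv)
      (o := q) (by simp only [ψ, hφq]; exact tendsto_const_nhds)
  obtain ⟨K, hK, hKE⟩ := energy_posPart_mul_le hp hC hm Γ Γ' hv hvs.1 hu hprod hgrad
  -- The same test functions `u⁺ ψ n`, now represented through the superharmonic `w` of the first
  -- operator.
  set χ : ℕ → X → ℝ := fun n x => u⁺ x * ψ n x / w x
  have hχ0 : ∀ n x, 0 ≤ χ n x := fun n x =>
    div_nonneg (mul_nonneg (hUnn x) (hψ0 n x)) (hw0 x).le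
  have hχS : ∀ n, ∀ x ∉ S n, χ n x = 0 := fun n x hx => by simp [χ, hψS n x hx]
  have hwχ : ∀ n, (fun x => w x * χ n x) = fun x => u⁺ x * ψ n x := fun n =>
    funext fun x => mul_div_cancel₀ _ (hw0 x).ne'
  have hEw : ∀ n, energy p Γ m V (fun x => w x * χ n x) ≤ K * (2 * (1 / ((n : ℝ) + 1))) := by
    intro n
    rw [hwχ]
    refine (hKE (ψ n) (S n) (hψ0 n) (hψS n)).trans (mul_le_mul_of_nonneg_left ?_ hK.le)
    have := tsum_edgePicone_le hp hm hvs hv (hψ0 n) (hψS n)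
    linarith [hEv n]
  have hlimK : Tendsto (fun n : ℕ => K * (2 * (1 / ((n : ℝ) + 1)))) atTop (𝓝 0) := by
    simpa using (tendsto_one_div_add_atTop_nhds_zero_nat (𝕜 := ℝ)).const_mul 2 |>.const_mul K
  have hχlim : ∀ x, Tendsto (fun n => χ n x) atTop (𝓝 (u⁺ x * (1 / v q) / w x)) := fun x =>
    ((hψlim x).const_mul _).div_const _
  have hχq := tendsto_of_edgePicone hp hΓ hw0 hχ0
    (tendsto_edgePicone hp hm hw hw0 hχ0 hχS hlimK hEw) (hχlim q) x
  -- The limit of `χ n x` is both its value at `q` and the one computed at `x`: `u⁺ / w` is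
  -- constant.
  have heq := tendsto_nhds_unique hχq (hχlim x)
  by_contra hcon
  have h0 : u⁺ x = 0 := max_eq_right (not_lt.1 hcon)
  rw [h0, zero_mul, zero_div] at heq
  have h1 := hv q
  have h2 := hw0 q
  have : 0 < u⁺ q * (1 / v q) / w q := by positivity
  exact this.ne' heq

/-! ### Comparison with the Green function and conclusion. -/

/-- A positive superharmonic function dominates a multiple of a positive solution of
minimal growth. -/
theorem MinimalGrowth.exists_le_mul {p : ℝ} (hp : 1 < p) {Γ : WeightedGraph X} {m V G u : X → ℝ}
    (hG : MinimalGrowth p Γ m V G) (hu : Superharmonic p Γ m V u) (hpos : ∀ x, 0 < u x) :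
    ∃ l > 0, ∀ᶠ x in cofinite, 0 < G x ∧ G x ≤ l * u x := by
  obtain ⟨-, -, K₀, hK₀, hmin⟩ := hG
  -- The sum dominates each ratio `G / u` on `K₀`; the summand `1` keeps `l` positive when it
  -- vanishes.
  set l := 1 + ∑ x ∈ K₀, |G x| / u x
  have hnn : ∀ x, 0 ≤ |G x| / u x := fun x => div_nonneg (abs_nonneg _) (hpos x).le
  have hl : 0 < l := add_pos_of_pos_of_nonneg one_pos (Finset.sum_nonneg fun x _ => hnn x)
  have h := hmin K₀ (Finset.Subset.refl _) (fun x => l * u x) (hu.1.smul hl.le)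
    (fun x _ => ⟨mul_pos hl (hpos x), by
      rw [schrodinger_smul Γ m V u hp hl.le]
      exact mul_nonneg (Real.rpow_nonneg hl.le _) (hu.2 x)⟩)
    (fun x hx => by
      have h1 := Finset.single_le_sum (fun y _ => hnn y) hx
      have h2 : |G x| / u x ≤ l := by simp only [l]; linarith
      exact (le_abs_self _).trans ((div_le_iff₀ (hpos x)).1 h2))
  refine ⟨l, hl, ?_⟩
  filter_upwards [K₀.finite_toSet.compl_mem_cofinite] with x hx
  exact ⟨(hK₀ x hx).1, h x hx⟩

/-- Raising the potential adds `(α - V) u^(p-1) ≥ 0`. -/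
theorem Harmonic.superharmonic_of_le {p : ℝ} {Γ : WeightedGraph X} {m V u : X → ℝ} {α : ℝ}
    (hV : ∀ x, V x ≤ α) (hu : Harmonic p Γ m V u) (hpos : ∀ x, 0 < u x) :
    Superharmonic p Γ m (fun _ => α) u := by
  refine ⟨hu.1, fun x => ?_⟩
  have h1 := hu.2 x
  have h2 : 0 ≤ spow (u x) (p - 1) :=
    mul_nonneg (hpos x).le (Real.rpow_nonneg (abs_nonneg _) _)
  unfold schrodinger at h1 ⊢
  nlinarith [mul_le_mul_of_nonneg_right (hV x) h2]

end QuasilinearGraph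

end

theorem theoremt {X : Type*} [Infinite X] [Countable X]
    (p : ℝ) (hp : 1 < p) (m : X → ℝ) (hm : ∀ x, 0 < m x)
    (Γ Γ' : QuasilinearGraph.WeightedGraph X) (hΓ : Γ.Connected) (hΓ' : Γ'.Connected)
    (V V' : X → ℝ)
    (hH : QuasilinearGraph.PositiveOperator p Γ m V) (hV : ∀ x, V x ≤ 1)
    (v : X → ℝ) (hv : ∀ x, 0 < v x) (hground : QuasilinearGraph.AgmonGroundState p Γ' m V' v)
    (o : X) (G : X → ℝ) (hG : QuasilinearGraph.GreenFunction p Γ m 1 o G)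
    (u : X → ℝ) (hu : QuasilinearGraph.Harmonic p Γ m V u) (hupos : u⁺ ≠ 0)
    (C : ℝ) (hC : 0 < C)
    (hprod : ∀ x y, 0 < u x → 0 < u y →
      Γ.b x y ^ (2 / p) * (u⁺ x * u⁺ y) ≤ C * (Γ'.b x y ^ (2 / p) * (v x * v y)))
    (hgrad : ∀ x y, 0 < u x → 0 < u y → 0 < Γ.b x y →
      QuasilinearGraph.gradWeight p (Γ.b x y) (u⁺ x - u⁺ y) ≤
        ENNReal.ofReal C * QuasilinearGraph.gradWeight p (Γ'.b x y) (v x - v y))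
    (hlim : liminf (fun x => ENNReal.ofReal (u⁺ x / G x)) cofinite = 0) :
    u = 0 := by
  have hpos := hu.pos_of_comparison hp hC hm hΓ hΓ' hH hv hground hupos hprod hgrad
  obtain ⟨l, hl, hle⟩ := hG.2.exists_le_mul hp (hu.superharmonic_of_le hV hpos) hpos
  -- The bound `G ≤ l u` off a finite set keeps the lower limit positive, so the conclusion follows
  -- from a contradiction.
  have h : ENNReal.ofReal (1 / l) ≤ liminf (fun x => ENNReal.ofReal (u⁺ x / G x)) cofinite := by
    refine le_liminf_of_le (by isBoundedDefault) ?_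
    filter_upwards [hle] with x ⟨hG0, hGu⟩
    refine ENNReal.ofReal_le_ofReal ?_
    have e : u⁺ x = u x := max_eq_left (hpos x).le
    rw [e, div_le_div_iff₀ hl hG0]
    linarith
  rw [hlim, nonpos_iff_eq_zero, ENNReal.ofReal_eq_zero] at h
  exact absurd h (not_le.2 (one_div_pos.2 hl))
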